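/- Let $n\ge 3$, $0<a<1$, $A=\{x\in\mathbb R^n:\ a<|x|<1\}$, and let $\omega_{n-1}$ be the area of the unit sphere of $\mathbb R^n$. A Green function of a bounded domain $\Omega$ is a function $G$ such that, for each $y\in\Omega$, $G(\cdot,y)$ is locally integrable in $\Omega$ and continuous on $\overline\Omega\setminus\{y\}$, satisfies $-\Delta_x G(x,y)=\delta_y(x)$ in $\Omega$ in the sense of distributions, and $G(x,y)=0$ for $x\in\partial\Omega$. The Robin function of $\Omega$ is $R(x)=H(x,x)$, where $G(x,y)=\frac{1}{(n-2)\omega_{n-1}|x-y|^{n-2}}+H(x,y)$ for $x\neq y$, with $H$ smooth in $\Omega\times\Omega$ and harmonic in each variable. For $x\in\mathbb R^n$ and $|\xi|=1$, let $Z_0(x,\xi)=1$ and, for $m\ge1$, $$Z_m(x,\xi)=(n+2m-2)\sum_{k=0}^{\lfloor m/2\rfloor}(-1)^k\frac{n(n+2)\cdots(n+2m-2k-4)}{2^k\,k!\,(m-2k)!}(x\cdot\xi)^{m-2k}|x|^{2k}$$ be the zonal harmonic of degree $m$ (the product has the $m-k-1$ factors $n+2j$, $0\le j\le m-k-2$,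 and is $1$ if $m-k-1=0$). Let $d_0=1$ and $d_m=\binom{n+m-2}{n-2}+\binom{n+m-3}{n-2}$ for $m\ge1$. Then the Green function $G_A$ and the Robin function $R_A$ of $A$ exist. For all $x,y\in A$ with $x\ne y$, $$G_A(x,y)=\frac{1}{(n-2)\omega_{n-1}|x-y|^{n-2}}-\frac1{\omega_{n-1}}\sum_{m=0}^\infty\frac{|x|^{2m+n-2}|y|^{2m+n-2}-a^{2m+n-2}\left(|x|^{2m+n-2}+|y|^{2m+n-2}\right)+a^{2m+n-2}}{(2m+n-2)(|x||y|)^{n+m-2}(1-a^{2m+n-2})}\,Z_m\!\left(\frac x{|x|},\frac y{|y|}\right),$$ and, for all $x\in A$, $$R_A(x)=-\frac1{\omega_{n-1}}\sum_{m=0}^\infty d_m\,\frac{a^{2m+n-2}-2a^{2m+n-2}|x|^{2m+n-2}+|x|^{4m+2n-4}}{(2m+n-2)|x|^{2m+2n-4}(1-a^{2m+n-2})},$$ both series being absolutely convergent. Moreover $d_m=\dim H_m$ for every $m\ge 0$, where $H_m$ is the space of harmonic homogeneous polynomials of degree $m$ in $n$ real variables. -/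

import Mathlib

open Set Filter Topology MeasureTheory Laplacian
open scoped ContDiff

noncomputable section

/-- The annulus `{x ∈ ℝⁿ : a < |x| < 1}`. -/
def annulus (n : ℕ) (a : ℝ) : Set (EuclideanSpace ℝ (Fin n)) :=
  {x | a < ‖x‖ ∧ ‖x‖ < 1}

/-- `ω_{n-1}`: the surface area of the unit sphere of `ℝⁿ`. -/
def sphereArea (n : ℕ) : ℝ :=
  (volume : Measure (EuclideanSpace ℝ (Fin n))).toSphere.real univ

/-- The Newtonian kernel `1 / ((n-2) ω_{n-1} |x-y|^{n-2})` of `ℝⁿ`, for `n ≥ 3`. -/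
def newtonKernel (n : ℕ) (x y : EuclideanSpace ℝ (Fin n)) : ℝ :=
  1 / (((n : ℝ) - 2) * sphereArea n * ‖x - y‖ ^ (n - 2))

/-- `G` is a Dirichlet Green function of `-Δ` in `Ω`: for every `y ∈ Ω`, the function `G(·, y)`
is locally integrable in `Ω`, satisfies `-Δ G(·, y) = δ_y` in the sense of distributions in `Ω`,
is continuous on `closure Ω` away from `y`, and vanishes on `∂Ω`. -/
structure IsGreenFunction {n : ℕ} (Ω : Set (EuclideanSpace ℝ (Fin n)))
    (G : EuclideanSpace ℝ (Fin n) → EuclideanSpace ℝ (Fin n) → ℝ) : Prop where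
  locallyIntegrableOn : ∀ y ∈ Ω, LocallyIntegrableOn (fun x => G x y) Ω volume
  neg_laplacian_eq_dirac : ∀ y ∈ Ω, ∀ φ : EuclideanSpace ℝ (Fin n) → ℝ,
    ContDiff ℝ ∞ φ → HasCompactSupport φ → tsupport φ ⊆ Ω →
      ∫ x in Ω, G x y * (-(Δ φ x)) = φ y
  continuousOn : ∀ y ∈ Ω, ContinuousOn (fun x => G x y) (closure Ω \ {y})
  eq_zero_on_boundary : ∀ y ∈ Ω, ∀ x ∈ frontier Ω, G x y = 0

/-- `H` is the regular part of `G` in `Ω`: it is smooth in `Ω × Ω`, harmonic in each variable, and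
`G(x, y) = 1 / ((n-2) ω_{n-1} |x-y|^{n-2}) + H(x, y)` for `x ≠ y`. -/
structure IsRegularPart {n : ℕ} (Ω : Set (EuclideanSpace ℝ (Fin n)))
    (G H : EuclideanSpace ℝ (Fin n) → EuclideanSpace ℝ (Fin n) → ℝ) : Prop where
  contDiffOn : ContDiffOn ℝ ∞ (Function.uncurry H) (Ω ×ˢ Ω)
  harmonic_left : ∀ y ∈ Ω, InnerProductSpace.HarmonicOnNhd (fun x => H x y) Ω
  harmonic_right : ∀ x ∈ Ω, InnerProductSpace.HarmonicOnNhd (fun y => H x y) Ω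
  eq_add : ∀ x ∈ Ω, ∀ y ∈ Ω, x ≠ y → G x y = newtonKernel n x y + H x y

/-- `R` is the Robin function of `Ω`: `R(x) = H(x, x)` in `Ω`, where `H` is the regular part of the
Green function of `Ω`. -/
def IsRobinFunction {n : ℕ} (Ω : Set (EuclideanSpace ℝ (Fin n)))
    (R : EuclideanSpace ℝ (Fin n) → ℝ) : Prop :=
  ∃ G H, IsGreenFunction Ω G ∧ IsRegularPart Ω G H ∧ ∀ x ∈ Ω, R x = H x x

/-- The zonal harmonic `Z_m(x, ξ)` of degree `m` on `ℝⁿ` (`ξ` a unit vector): `Z_0 = 1`, and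
`Z_m(x, ξ) = (n+2m-2) ∑_{k=0}^{⌊m/2⌋} (-1)^k n(n+2)⋯(n+2m-2k-4) / (2^k k! (m-2k)!)
(x·ξ)^{m-2k} |x|^{2k}` for `m > 0`. The product has the `m-k-1` factors `n + 2j`. -/
def zonalHarmonic (n m : ℕ) (x ξ : EuclideanSpace ℝ (Fin n)) : ℝ :=
  if m = 0 then 1 else
    ((n : ℝ) + 2 * m - 2) * ∑ k ∈ Finset.range (m / 2 + 1),
      (-1 : ℝ) ^ k * (∏ j ∈ Finset.range (m - k - 1), ((n : ℝ) + 2 * j)) /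
          (2 ^ k * (k.factorial : ℝ) * ((m - 2 * k).factorial : ℝ)) *
        (inner ℝ x ξ) ^ (m - 2 * k) * ‖x‖ ^ (2 * k)

/-- The space `H_m(ℝⁿ)` of harmonic homogeneous polynomials of degree `m` in `n` variables. -/
def harmonicPolynomials (n m : ℕ) : Submodule ℝ (MvPolynomial (Fin n) ℝ) :=
  MvPolynomial.homogeneousSubmodule (Fin n) ℝ m ⊓
    LinearMap.ker (∑ i : Fin n, (MvPolynomial.pderiv (R := ℝ) i).toLinearMap ∘ₗ
      (MvPolynomial.pderiv (R := ℝ) i).toLinearMap)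

/-- The weights `d_0 = 1` and `d_m = C(n+m-2, n-2) + C(n+m-3, n-2)` for `m ≥ 1`. -/
def harmonicWeight (n m : ℕ) : ℕ :=
  if m = 0 then 1 else (n + m - 2).choose (n - 2) + (n + m - 3).choose (n - 2)

end

/-! The regular part comes from the method of images. Write s = (n-2)/2. Repeated reflection of a
charge in the spheres |x| = a and |x| = 1 yields potentials that are powers -s of quadratics α|x|² -
2⟨x,b⟩ + γ with αγ = |b|², hence harmonic (`laplacian_rpow_quadratic`). Grouped by four, with
parameter l = a^(2j) and weight a^((n-2)j), they form `imageSeries`. It is smooth up to both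
boundary spheres, because the weights are geometric and l stays in the compact interval [0,1]
(`contDiffAt_tsum_param`). On either sphere the series telescopes to |x-y|^(2-n)
(`imageSeries_of_norm_eq_one`, `imageSeries_of_norm_eq_inner`), so subtracting 1/((n-2)ω) times it
from the Newtonian kernel gives zero boundary values; the Dirac mass is supplied by
`integral_newtonKernel_mul_laplacian`.

The formulas concern every Green function, so uniqueness is needed. The difference of two Green
functions is weakly harmonic even across the pole and vanishes on the boundary; mollification and
the maximum principle make it zero off the pole (`eq_zero_of_weakly_harmonic`). Continuity of the
regular part then determines the Robin function on the diagonal.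

For the zonal expansion, each image is expanded by the generating function of the Gegenbauer
polynomials C_m^s (`hasSum_gegenbauer`). After the two sums are exchanged, the sum over j is
geometric of ratio a^(2m+n-2), whence the denominator 1 - a^(2m+n-2) (`hasSum_imageSeries`). Z_m is
a multiple of C_m^s, and C_m^s(1) is a binomial coefficient, which gives the weights d_m on the
diagonal. They are dimensions because the Laplacian maps degree m+2 onto degree m
(`map_polyLaplacian`) and rank-nullity applies. -/

lemma two_le_infty : (2 : WithTop ℕ∞) ≤ ∞ := by
  norm_cast

/-! ### Laplacians of powers of quadratics, and Green's second identity. -/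

section LaplacianTools

variable {E : Type*} [NormedAddCommGroup E] [InnerProductSpace ℝ E]

lemma fderiv_fderiv_apply_eq {f : E → ℝ} {x : E} (hf : ContDiffAt ℝ 2 f x) (v w : E) :
    fderiv ℝ (fun z => fderiv ℝ f z v) x w = fderiv ℝ (fderiv ℝ f) x w v := by
  have h : DifferentiableAt ℝ (fderiv ℝ f) x :=
    (hf.fderiv_right (m := 1) (by norm_num)).differentiableAt (by norm_num)
  rw [fderiv_clm_apply h (differentiableAt_const v)]
  simp

lemma hasFDerivAt_rpow_quadratic (α γ s : ℝ) (b x : E)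
    (hx : 0 < α * ‖x‖ ^ 2 - 2 * inner ℝ x b + γ) :
    HasFDerivAt (fun z : E => (α * ‖z‖ ^ 2 - 2 * inner ℝ z b + γ) ^ s)
      ((s * (α * ‖x‖ ^ 2 - 2 * inner ℝ x b + γ) ^ (s - 1)) •
        (2 • innerSL ℝ (α • x - b))) x := by
  have h1 : HasFDerivAt (fun z : E => ‖z‖ ^ 2) (2 • innerSL ℝ x) x :=
    (hasStrictFDerivAt_norm_sq x).hasFDerivAt
  have h2 : HasFDerivAt (fun z : E => inner ℝ z b) (innerSL ℝ b) x := by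
    have := (innerSL ℝ b).hasFDerivAt (x := x)
    refine this.congr_of_eventuallyEq (Eventually.of_forall fun z => ?_)
    simp [real_inner_comm]
  have h3 := ((h1.const_mul α).sub (h2.const_mul 2)).add_const γ
  have h4 := h3.rpow_const (p := s) (Or.inl hx.ne')
  refine h4.congr_fderiv ?_
  ext v
  simp only [_root_.smul_apply, _root_.sub_apply, innerSL_apply_apply,
    smul_eq_mul, nsmul_eq_mul, inner_sub_left, real_inner_smul_left, Pi.sub_apply]
  push_cast
  ring

lemma contDiff_quadratic (α γ : ℝ) (b : E) :
    ContDiff ℝ ∞ (fun z : E => α * ‖z‖ ^ 2 - 2 * inner ℝ z b + γ) := by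
  have : ContDiff ℝ ∞ (fun z : E => ‖z‖ ^ 2) := contDiff_norm_sq ℝ
  have h2 : ContDiff ℝ ∞ (fun z : E => inner ℝ z b) := contDiff_id.inner ℝ contDiff_const
  exact ((contDiff_const.mul this).sub (contDiff_const.mul h2)).add contDiff_const

lemma contDiffAt_rpow_quadratic (α γ s : ℝ) (b x : E)
    (hx : 0 < α * ‖x‖ ^ 2 - 2 * inner ℝ x b + γ) :
    ContDiffAt ℝ ∞ (fun z : E => (α * ‖z‖ ^ 2 - 2 * inner ℝ z b + γ) ^ s) x :=
  (contDiff_quadratic α γ b).contDiffAt.rpow_const_of_ne hx.ne'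

variable [FiniteDimensional ℝ E]

/-- The Laplacian is the sum of the pure second derivatives along an orthonormal basis. -/
lemma laplacian_eq_sum_fderiv_fderiv {ι : Type*} [Fintype ι] (b : OrthonormalBasis ι ℝ E)
    {f : E → ℝ} {x : E} (hf : ContDiffAt ℝ 2 f x) :
    Δ f x = ∑ i, fderiv ℝ (fun z => fderiv ℝ f z (b i)) x (b i) := by
  rw [InnerProductSpace.laplacian_eq_iteratedFDeriv_orthonormalBasis f b]
  simp [iteratedFDeriv_two_apply, fderiv_fderiv_apply_eq hf]

/-- The Laplacian of a power of a quadratic polynomial `α|x|² - 2⟨x, b⟩ + γ`. -/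
lemma laplacian_rpow_quadratic (α γ s : ℝ) (b x : E)
    (hx : 0 < α * ‖x‖ ^ 2 - 2 * inner ℝ x b + γ) :
    Δ ((fun z => (α * ‖z‖ ^ 2 - 2 * inner ℝ z b + γ) ^ s : E → ℝ)) x =
      2 * s * α * (2 * (s - 1) + Module.finrank ℝ E) *
          (α * ‖x‖ ^ 2 - 2 * inner ℝ x b + γ) ^ (s - 1) -
        4 * s * (s - 1) * (α * γ - ‖b‖ ^ 2) *
          (α * ‖x‖ ^ 2 - 2 * inner ℝ x b + γ) ^ (s - 2) := by
  set e := stdOrthonormalBasis ℝ E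
  rw [laplacian_eq_sum_fderiv_fderiv e
    ((contDiffAt_rpow_quadratic α γ s b x hx).of_le two_le_infty)]
  have hnear : ∀ᶠ z in 𝓝 x, 0 < α * ‖z‖ ^ 2 - 2 * inner ℝ z b + γ :=
    (contDiff_quadratic α γ b).continuous.continuousAt.eventually (lt_mem_nhds hx)
  have key (v : E) : fderiv ℝ (fun z => fderiv ℝ
      (fun z : E => (α * ‖z‖ ^ 2 - 2 * inner ℝ z b + γ) ^ s) z v) x v =
      4 * s * (s - 1) * (α * ‖x‖ ^ 2 - 2 * inner ℝ x b + γ) ^ (s - 2) * inner ℝ v (α • x - b) ^ 2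
        + 2 * s * α * (α * ‖x‖ ^ 2 - 2 * inner ℝ x b + γ) ^ (s - 1) * ‖v‖ ^ 2 := by
    have h1 : (fun z => fderiv ℝ (fun z : E => (α * ‖z‖ ^ 2 - 2 * inner ℝ z b + γ) ^ s) z v)
        =ᶠ[𝓝 x] fun z => (α * ‖z‖ ^ 2 - 2 * inner ℝ z b + γ) ^ (s - 1) *
          (2 * s * innerSL ℝ v (α • z - b)) := by
      filter_upwards [hnear] with z hz
      rw [(hasFDerivAt_rpow_quadratic α γ s b z hz).fderiv]
      simp only [_root_.smul_apply, innerSL_apply_apply, smul_eq_mul, nsmul_eq_mul]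
      rw [real_inner_comm v]
      push_cast
      ring
    rw [h1.fderiv_eq]
    have h2 := hasFDerivAt_rpow_quadratic α γ (s - 1) b x hx
    have h3 : HasFDerivAt (fun z : E => 2 * s * innerSL ℝ v (α • z - b))
        ((2 * s) • (innerSL ℝ v).comp (α • ContinuousLinearMap.id ℝ E)) x :=
      ((innerSL ℝ v).hasFDerivAt.comp x
        (((hasFDerivAt_id x).const_smul α).sub_const b)).const_mul (2 * s)
    rw [(h2.fun_mul h3).fderiv]
    simp only [_root_.add_apply, _root_.smul_apply, innerSL_apply_apply,
      smul_eq_mul, nsmul_eq_mul, ContinuousLinearMap.comp_apply, ContinuousLinearMap.id_apply]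
    rw [real_inner_comm v, real_inner_smul_right, real_inner_self_eq_norm_sq]
    rw [show s - 1 - 1 = s - 2 by ring]
    push_cast
    ring
  simp_rw [key]
  rw [Finset.sum_add_distrib, ← Finset.mul_sum, ← Finset.mul_sum]
  have hs : ∑ i, inner ℝ (e i) (α • x - b) ^ 2 = ‖α • x - b‖ ^ 2 := by
    rw [← e.sum_sq_norm_inner_right]
    simp
  have hn : ‖α • x - b‖ ^ 2 =
      α * (α * ‖x‖ ^ 2 - 2 * inner ℝ x b + γ) - (α * γ - ‖b‖ ^ 2) := by
    rw [norm_sub_sq_real, norm_smul, mul_pow, real_inner_smul_left, Real.norm_eq_abs, sq_abs]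
    ring
  have hp : (α * ‖x‖ ^ 2 - 2 * inner ℝ x b + γ) ^ (s - 1) =
      (α * ‖x‖ ^ 2 - 2 * inner ℝ x b + γ) ^ (s - 2) * (α * ‖x‖ ^ 2 - 2 * inner ℝ x b + γ) := by
    rw [← Real.rpow_add_one hx.ne']
    ring_nf
  rw [hs, hn, hp]
  simp
  ring

/-- Powers `-(d-2)/2` of quadratic polynomials with discriminant zero are harmonic. -/
lemma harmonicAt_rpow_quadratic (α γ : ℝ) (b x : E) (h0 : α * γ = ‖b‖ ^ 2)
    (hx : 0 < α * ‖x‖ ^ 2 - 2 * inner ℝ x b + γ) :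
    InnerProductSpace.HarmonicAt (fun z : E => (α * ‖z‖ ^ 2 - 2 * inner ℝ z b + γ) ^
      (-(((Module.finrank ℝ E : ℝ) - 2) / 2))) x := by
  refine ⟨(contDiffAt_rpow_quadratic α γ _ b x hx).of_le two_le_infty, ?_⟩
  filter_upwards [(contDiff_quadratic α γ b).continuous.continuousAt.eventually
    (lt_mem_nhds hx)] with z hz
  rw [laplacian_rpow_quadratic α γ _ b z hz, h0]
  simp only [Pi.zero_apply]
  ring

lemma continuous_laplacian {f : E → ℝ} (hf : ContDiff ℝ 2 f) : Continuous (Δ f) := by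
  rw [InnerProductSpace.laplacian_eq_iteratedFDeriv_stdOrthonormalBasis f]
  refine continuous_finsetSum _ fun i _ => ?_
  have := hf.continuous_iteratedFDeriv (m := 2) le_rfl
  fun_prop

lemma tsupport_laplacian_subset {f : E → ℝ} : tsupport (Δ f) ⊆ tsupport f := by
  refine closure_minimal (fun x hx => ?_) (isClosed_tsupport f)
  by_contra hx'
  refine hx ?_
  have h0 : f =ᶠ[𝓝 x] fun _ => 0 := notMem_tsupport_iff_eventuallyEq.1 hx'
  have := (InnerProductSpace.laplacian_congr_nhds h0).eq_of_nhds
  simpa using this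

/-- Lets `f` be singular away from the support of the test function. -/
lemma continuous_mul_of_continuousAt_tsupport {X : Type*} [TopologicalSpace X] {f g : X → ℝ}
    (hf : ∀ x ∈ tsupport g, ContinuousAt f x) (hg : Continuous g) :
    Continuous fun x => f x * g x := by
  rw [continuous_iff_continuousAt]
  intro x
  by_cases hx : x ∈ tsupport g
  · exact (hf x hx).mul hg.continuousAt
  · have h : (fun x => f x * g x) =ᶠ[𝓝 x] fun _ => 0 := by
      filter_upwards [notMem_tsupport_iff_eventuallyEq.1 hx] with z hz
      simp [hz]
    exact continuousAt_const.congr h.symm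

variable [MeasurableSpace E] [BorelSpace E]

lemma integrable_mul_of_continuousAt_tsupport {f g : E → ℝ}
    (hf : ∀ x ∈ tsupport g, ContinuousAt f x) (hg : Continuous g) (hc : HasCompactSupport g) :
    Integrable fun x => f x * g x :=
  (continuous_mul_of_continuousAt_tsupport hf hg).integrable_of_hasCompactSupport hc.mul_left

/-- Green's second identity for a compactly supported test function. -/
lemma integral_mul_laplacian_eq {f φ : E → ℝ} (hφ : ContDiff ℝ 2 φ) (hc : HasCompactSupport φ)
    (hf : ∀ x ∈ tsupport φ, ContDiffAt ℝ 2 f x) :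
    ∫ x, f x * Δ φ x = ∫ x, Δ f x * φ x := by
  set b := stdOrthonormalBasis ℝ E
  have hts (v : E) : tsupport (fun z => fderiv ℝ φ z v) ⊆ tsupport φ :=
    tsupport_fderiv_apply_subset ℝ v
  have hφ' (v : E) : ContDiff ℝ 1 (fun z => fderiv ℝ φ z v) :=
    (hφ.fderiv_right (m := 1) (by norm_num)).clm_apply contDiff_const
  have hc' (v : E) : HasCompactSupport (fun z => fderiv ℝ φ z v) :=
    hc.fderiv_apply ℝ v
  have hφ'' (v w : E) : Continuous (fun x => fderiv ℝ (fun z => fderiv ℝ φ z v) x w) :=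
    (((hφ' v).fderiv_right (m := 0) (by norm_num)).clm_apply contDiff_const).continuous
  have hc'' (v w : E) : HasCompactSupport (fun x => fderiv ℝ (fun z => fderiv ℝ φ z v) x w) :=
    (hc' v).fderiv_apply ℝ w
  have hts'' (v w : E) : tsupport (fun x => fderiv ℝ (fun z => fderiv ℝ φ z v) x w) ⊆ tsupport φ :=
    (tsupport_fderiv_apply_subset ℝ w).trans (hts v)
  have hfd (v : E) {x : E} (hx : x ∈ tsupport φ) : ContDiffAt ℝ 1 (fun z => fderiv ℝ f z v) x :=
    ((hf x hx).fderiv_right (m := 1) (by norm_num)).clm_apply contDiffAt_const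
  have hfdd (v w : E) {x : E} (hx : x ∈ tsupport φ) :
      ContinuousAt (fun x => fderiv ℝ (fun z => fderiv ℝ f z v) x w) x :=
    (((hfd v hx).fderiv_right (m := 0) (by norm_num)).clm_apply contDiffAt_const).continuousAt
  have hI1 (v : E) : Integrable fun x => f x * fderiv ℝ (fun z => fderiv ℝ φ z v) x v :=
    integrable_mul_of_continuousAt_tsupport
      (fun x hx => (hf x (hts'' v v hx)).continuousAt) (hφ'' v v) (hc'' v v)
  have hI2 (v : E) : Integrable fun x => fderiv ℝ f x v * fderiv ℝ φ x v :=
    integrable_mul_of_continuousAt_tsupport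
      (fun x hx => (hfd v (hts v hx)).continuousAt) (hφ' v).continuous (hc' v)
  have hI3 (v : E) : Integrable fun x => fderiv ℝ (fun z => fderiv ℝ f z v) x v * φ x :=
    integrable_mul_of_continuousAt_tsupport (fun x hx => hfdd v v hx) hφ.continuous hc
  have hI4 (v : E) : Integrable fun x => f x * fderiv ℝ φ x v :=
    integrable_mul_of_continuousAt_tsupport
      (fun x hx => (hf x (hts v hx)).continuousAt) (hφ' v).continuous (hc' v)
  have hI5 (v : E) : Integrable fun x => fderiv ℝ f x v * φ x :=
    integrable_mul_of_continuousAt_tsupport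
      (fun x hx => (hfd v hx).continuousAt) hφ.continuous hc
  have key (v : E) : ∫ x, f x * fderiv ℝ (fun z => fderiv ℝ φ z v) x v =
      ∫ x, fderiv ℝ (fun z => fderiv ℝ f z v) x v * φ x := by
    have h1 := integral_mul_fderiv_eq_neg_fderiv_mul_of_integrable (μ := (volume : Measure E))
      (f := f) (g := fun z => fderiv ℝ φ z v) (v := v) (hI2 v) (hI1 v) (hI4 v)
      (fun x hx => (hf x (hts v hx)).differentiableAt (by norm_num))
      (fun x _ => ((hφ' v).differentiable (by norm_num)) x)
    have h2 := integral_mul_fderiv_eq_neg_fderiv_mul_of_integrable (μ := (volume : Measure E))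
      (f := fun z => fderiv ℝ f z v) (g := φ) (v := v) (hI3 v) (hI2 v) (hI5 v)
      (fun x hx => (hfd v hx).differentiableAt (by norm_num))
      (fun x _ => (hφ.differentiable (by norm_num)) x)
    rw [h1, h2, neg_neg]
  have e1 : ∫ x, f x * Δ φ x =
      ∫ x, ∑ i, f x * fderiv ℝ (fun z => fderiv ℝ φ z (b i)) x (b i) := by
    congr 1
    ext x
    rw [laplacian_eq_sum_fderiv_fderiv b hφ.contDiffAt, Finset.mul_sum]
  have e2 : ∫ x, Δ f x * φ x =
      ∫ x, ∑ i, fderiv ℝ (fun z => fderiv ℝ f z (b i)) x (b i) * φ x := by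
    congr 1
    ext x
    -- Off the support `f` need not be differentiable, but there `φ` kills both sides.
    by_cases hx : x ∈ tsupport φ
    · rw [laplacian_eq_sum_fderiv_fderiv b (hf x hx), Finset.sum_mul]
    · simp [image_eq_zero_of_notMem_tsupport hx]
  rw [e1, e2, integral_finsetSum _ fun i _ => hI1 (b i), integral_finsetSum _ fun i _ => hI3 (b i)]
  exact Finset.sum_congr rfl fun i _ => key (b i)

end LaplacianTools

/-! ### The fundamental solution of the Laplacian. -/

section NewtonKernel

variable {n : ℕ}

lemma rpow_newton_exponent {r : ℝ} (hr : 0 ≤ r) (hn : 3 ≤ n) :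
    (r ^ 2) ^ (-(((n : ℝ) - 2) / 2)) = (r ^ (n - 2))⁻¹ := by
  rw [Real.rpow_neg (by positivity), ← Real.rpow_natCast r 2, ← Real.rpow_mul hr,
    ← Real.rpow_natCast r (n - 2), Nat.cast_sub (by omega)]
  congr 2
  push_cast
  ring

/-- Writing the kernel as a real power of a squared norm puts it in the scope of
`laplacian_rpow_quadratic`. At x = y both sides take the default value 0. -/
lemma newtonKernel_eq (hn : 3 ≤ n) (x y : EuclideanSpace ℝ (Fin n)) :
    newtonKernel n x y =
      1 / (((n : ℝ) - 2) * sphereArea n) * (‖x - y‖ ^ 2) ^ (-(((n : ℝ) - 2) / 2)) := by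
  rw [newtonKernel, rpow_newton_exponent (norm_nonneg _) hn]
  field_simp

lemma sphereArea_eq (n : ℕ) : sphereArea n =
    n * (volume : Measure (EuclideanSpace ℝ (Fin n))).real (Metric.ball 0 1) := by
  simp [sphereArea]

lemma sphereArea_pos (hn : 0 < n) : 0 < sphereArea n := by
  rw [sphereArea_eq]
  have : 0 < (volume : Measure (EuclideanSpace ℝ (Fin n))).real (Metric.ball 0 1) :=
    ENNReal.toReal_pos (Metric.measure_ball_pos _ _ one_pos).ne' measure_ball_lt_top.ne
  positivity

/-- In polar coordinates the integrand becomes r^(n-1) r^(2-n) = r. -/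
lemma locallyIntegrable_rpow_norm (hn : 3 ≤ n) :
    LocallyIntegrable
      (fun x : EuclideanSpace ℝ (Fin n) => (‖x‖ ^ 2) ^ (-(((n : ℝ) - 2) / 2))) := by
  have : Nonempty (Fin n) := ⟨⟨0, by omega⟩⟩
  rw [locallyIntegrable_iff]
  intro K hK
  obtain ⟨r, hr⟩ := hK.isBounded.subset_ball 0
  refine IntegrableOn.mono_set ?_ hr
  rw [integrableOn_fun_norm_addHaar (volume : Measure (EuclideanSpace ℝ (Fin n)))
    (f := fun y => (y ^ 2) ^ (-(((n : ℝ) - 2) / 2)))]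
  have h : IntegrableOn (fun y : ℝ => y) (Ioo 0 r) :=
    (continuous_id.integrableOn_Icc (a := 0) (b := r)).mono_set Ioo_subset_Icc_self
  refine h.congr_fun (fun y hy => ?_) measurableSet_Ioo
  have hy : 0 < y := hy.1
  simp only [finrank_euclideanSpace, Fintype.card_fin, smul_eq_mul]
  rw [rpow_newton_exponent hy.le hn, show n - 1 = (n - 2) + 1 by omega, pow_succ]
  field_simp

lemma tendsto_radial_primitive :
    Tendsto (fun r : ℝ => (r ^ 2 / (1 + r ^ 2)) ^ ((n : ℝ) / 2)) atTop (𝓝 1) := by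
  have h1 : Tendsto (fun r : ℝ => r ^ 2 / (1 + r ^ 2)) atTop (𝓝 1) := by
    have h2 : Tendsto (fun r : ℝ => 1 - (1 + r ^ 2)⁻¹) atTop (𝓝 (1 - 0)) :=
      tendsto_const_nhds.sub (tendsto_inv_atTop_zero.comp
        (tendsto_atTop_add_const_left _ _ (tendsto_pow_atTop two_ne_zero)))
    rw [sub_zero] at h2
    refine h2.congr fun r => ?_
    have : (1 : ℝ) + r ^ 2 ≠ 0 := by positivity
    field_simp
    ring
  simpa using h1.rpow_const (p := (n : ℝ) / 2) (Or.inl one_ne_zero)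

/-- The profile n(1+r²)^(-n/2-1) times r^(n-1) has an explicit primitive, rising from 0 at r = 0 to
1 at infinity. This is what makes the total mass of the profile equal to the sphere area. -/
lemma hasDerivAt_radial_primitive (hn : 0 < n) {r : ℝ} (hr : 0 < r) :
    HasDerivAt (fun r : ℝ => (r ^ 2 / (1 + r ^ 2)) ^ ((n : ℝ) / 2))
      (r ^ (n - 1) * (n * (1 + r ^ 2) ^ (-(((n : ℝ) - 2) / 2) - 2))) r := by
  have hp : (0 : ℝ) < 1 + r ^ 2 := by positivity
  have h1 : HasDerivAt (fun r : ℝ => r ^ 2 / (1 + r ^ 2)) (2 * r / (1 + r ^ 2) ^ 2) r := by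
    have := (hasDerivAt_pow 2 r).fun_div ((hasDerivAt_pow 2 r).const_add 1) hp.ne'
    refine this.congr_deriv ?_
    field_simp
    push_cast
    ring
  refine (h1.rpow_const (p := (n : ℝ) / 2) (Or.inl (by positivity))).congr_deriv ?_
  rw [Real.div_rpow (by positivity) hp.le, ← Real.rpow_natCast r 2, ← Real.rpow_mul hr.le,
    Real.rpow_natCast r 2]
  have e1 : r ^ (((2 : ℕ) : ℝ) * ((n : ℝ) / 2 - 1)) = r ^ (n - 1) / r := by
    rw [eq_div_iff hr.ne', ← Real.rpow_add_one hr.ne', ← Real.rpow_natCast r (n - 1),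
      Nat.cast_sub (by omega)]
    congr 1
    push_cast
    ring
  have e2 : (1 + r ^ 2) ^ (-(((n : ℝ) - 2) / 2) - 2) =
      ((1 + r ^ 2) ^ ((n : ℝ) / 2 - 1) * (1 + r ^ 2) ^ 2)⁻¹ := by
    rw [← Real.rpow_natCast (1 + r ^ 2) 2, ← Real.rpow_add hp, ← Real.rpow_neg hp.le]
    congr 1
    push_cast
    ring
  rw [e1, e2]
  field_simp

lemma continuousWithinAt_radial_primitive :
    ContinuousWithinAt (fun r : ℝ => (r ^ 2 / (1 + r ^ 2)) ^ ((n : ℝ) / 2)) (Ici 0) 0 := by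
  refine Continuous.continuousWithinAt ?_
  refine Continuous.rpow_const (Continuous.div (by fun_prop) (by fun_prop) fun r => ?_) fun r =>
    Or.inr (by positivity)
  positivity

lemma integrable_radial_bump (hn : 0 < n) :
    Integrable (fun x : EuclideanSpace ℝ (Fin n) =>
      n * (1 + ‖x‖ ^ 2) ^ (-(((n : ℝ) - 2) / 2) - 2)) := by
  have : Nonempty (Fin n) := ⟨⟨0, by omega⟩⟩
  rw [integrable_fun_norm_addHaar (volume : Measure (EuclideanSpace ℝ (Fin n)))
    (f := fun r => n * (1 + r ^ 2) ^ (-(((n : ℝ) - 2) / 2) - 2))]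
  simp only [finrank_euclideanSpace, Fintype.card_fin, smul_eq_mul]
  exact integrableOn_Ioi_deriv_of_nonneg continuousWithinAt_radial_primitive
    (fun r hr => hasDerivAt_radial_primitive hn hr)
    (fun r hr => by have : (0 : ℝ) < r := hr; positivity) tendsto_radial_primitive

lemma integral_radial_bump (hn : 0 < n) :
    ∫ x : EuclideanSpace ℝ (Fin n), n * (1 + ‖x‖ ^ 2) ^ (-(((n : ℝ) - 2) / 2) - 2) =
      sphereArea n := by
  have : Nonempty (Fin n) := ⟨⟨0, by omega⟩⟩
  rw [integral_fun_norm_addHaar (volume : Measure (EuclideanSpace ℝ (Fin n)))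
    (f := fun r => n * (1 + r ^ 2) ^ (-(((n : ℝ) - 2) / 2) - 2))]
  simp only [finrank_euclideanSpace, Fintype.card_fin, smul_eq_mul, nsmul_eq_mul]
  rw [integral_Ioi_of_hasDerivAt_of_nonneg continuousWithinAt_radial_primitive
    (fun r hr => hasDerivAt_radial_primitive hn hr)
    (fun r hr => by have : (0 : ℝ) < r := hr; positivity) tendsto_radial_primitive,
    sphereArea_eq]
  have : ((n : ℝ) / 2) ≠ 0 := by positivity
  simp [Real.zero_rpow this]

/-- The regularized kernel is smooth, so Green's identity applies. The exponent kills the first term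
of `laplacian_rpow_quadratic`; what remains is -n(n-2) ε² (|x|²+ε²)^(s-2), an approximate identity
that the substitution x ↦ εx turns into a fixed profile. -/
lemma integral_regularized_mul_laplacian (hn : 3 ≤ n) {φ : EuclideanSpace ℝ (Fin n) → ℝ}
    (hφ : ContDiff ℝ 2 φ) (hc : HasCompactSupport φ) {ε : ℝ} (hε : 0 < ε) :
    ∫ x, (‖x‖ ^ 2 + ε ^ 2) ^ (-(((n : ℝ) - 2) / 2)) * Δ φ x =
      -((n : ℝ) - 2) * ∫ x, n * (1 + ‖x‖ ^ 2) ^ (-(((n : ℝ) - 2) / 2) - 2) * φ (ε • x) := by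
  set s : ℝ := -(((n : ℝ) - 2) / 2) with hs
  have hq (x : EuclideanSpace ℝ (Fin n)) :
      1 * ‖x‖ ^ 2 - 2 * inner ℝ x (0 : EuclideanSpace ℝ (Fin n)) + ε ^ 2 = ‖x‖ ^ 2 + ε ^ 2 := by
    simp
  have hpos (x : EuclideanSpace ℝ (Fin n)) :
      0 < 1 * ‖x‖ ^ 2 - 2 * inner ℝ x (0 : EuclideanSpace ℝ (Fin n)) + ε ^ 2 := by
    rw [hq]; positivity
  have h1 := integral_mul_laplacian_eq hφ hc fun x _ =>
    (contDiffAt_rpow_quadratic 1 (ε ^ 2) s 0 x (hpos x)).of_le two_le_infty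
  have h2 (x : EuclideanSpace ℝ (Fin n)) := laplacian_rpow_quadratic 1 (ε ^ 2) s 0 x (hpos x)
  simp_rw [hq] at h1 h2
  rw [h1]
  have h3 := Measure.integral_comp_smul (volume : Measure (EuclideanSpace ℝ (Fin n)))
    (fun x => n * ε ^ 2 * (‖x‖ ^ 2 + ε ^ 2) ^ (s - 2) * φ x) ε
  have h4 (x : EuclideanSpace ℝ (Fin n)) :
      n * ε ^ 2 * (‖ε • x‖ ^ 2 + ε ^ 2) ^ (s - 2) * φ (ε • x) =
        (ε ^ n)⁻¹ * (n * (1 + ‖x‖ ^ 2) ^ (s - 2) * φ (ε • x)) := by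
    have e1 : ‖ε • x‖ ^ 2 + ε ^ 2 = ε ^ 2 * (1 + ‖x‖ ^ 2) := by
      rw [norm_smul, mul_pow, Real.norm_eq_abs, sq_abs]
      ring
    have e2 : (ε ^ 2) ^ (s - 2) = (ε ^ n)⁻¹ / ε ^ 2 := by
      rw [← Real.rpow_natCast ε n, ← Real.rpow_natCast ε 2, ← Real.rpow_mul hε.le,
        ← Real.rpow_neg hε.le, ← Real.rpow_sub hε, hs]
      congr 1
      push_cast
      ring
    rw [e1, Real.mul_rpow (by positivity) (by positivity), e2]
    field_simp
  simp_rw [h4] at h3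
  rw [integral_const_mul, finrank_euclideanSpace, Fintype.card_fin,
    abs_of_pos (by positivity), smul_eq_mul] at h3
  have hε' : (ε ^ n)⁻¹ ≠ 0 := by positivity
  rw [mul_left_cancel₀ hε' h3, ← integral_const_mul]
  congr 1
  ext x
  rw [h2 x]
  simp only [finrank_euclideanSpace, Fintype.card_fin, norm_zero]
  rw [hs]
  ring

/-- `|x|^{2-n}` is, up to normalization, the fundamental solution of the Laplacian. -/
lemma integral_rpow_norm_mul_laplacian (hn : 3 ≤ n) {φ : EuclideanSpace ℝ (Fin n) → ℝ}
    (hφ : ContDiff ℝ 2 φ) (hc : HasCompactSupport φ) :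
    ∫ x, (‖x‖ ^ 2) ^ (-(((n : ℝ) - 2) / 2)) * Δ φ x = -((n : ℝ) - 2) * sphereArea n * φ 0 := by
  have : Nonempty (Fin n) := ⟨⟨0, by omega⟩⟩
  have hn' : (3 : ℝ) ≤ n := by exact_mod_cast hn
  set s : ℝ := -(((n : ℝ) - 2) / 2) with hs
  have hs0 : s < 0 := by rw [hs]; linarith
  have hΔ : Continuous (Δ φ) := continuous_laplacian hφ
  have hΔc : HasCompactSupport (Δ φ) :=
    hc.of_isClosed_subset (isClosed_tsupport _) tsupport_laplacian_subset
  have hev : ∀ᶠ ε : ℝ in 𝓝[>] 0, 0 < ε := eventually_mem_nhdsWithin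
  have hne : ∀ᵐ x : EuclideanSpace ℝ (Fin n), x ≠ 0 := by
    rw [ae_iff]
    simp
  have hid : Tendsto (fun ε : ℝ => ε) (𝓝[>] 0) (𝓝 0) := nhdsWithin_le_nhds
  have hL : Tendsto (fun ε : ℝ => ∫ x, (‖x‖ ^ 2 + ε ^ 2) ^ s * Δ φ x) (𝓝[>] 0)
      (𝓝 (∫ x, (‖x‖ ^ 2) ^ s * Δ φ x)) := by
    refine tendsto_integral_filter_of_dominated_convergence
      (fun x => ‖(‖x‖ ^ 2) ^ s * Δ φ x‖) ?_ ?_ ?_ ?_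
    · filter_upwards [hev] with ε hε
      refine Continuous.aestronglyMeasurable (Continuous.mul ?_ hΔ)
      exact Continuous.rpow_const (by fun_prop) fun x => Or.inl (by positivity)
    · filter_upwards [hev] with ε hε
      filter_upwards [hne] with x hx
      have : 0 < ‖x‖ := norm_pos_iff.2 hx
      rw [norm_mul, norm_mul]
      gcongr
      rw [Real.norm_of_nonneg (by positivity), Real.norm_of_nonneg (by positivity)]
      -- The exponent is negative, so adding ε² to the base only decreases the power: the singular
      -- kernel dominates.
      exact Real.rpow_le_rpow_of_nonpos (by positivity) (by nlinarith) hs0.le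
    · exact ((locallyIntegrable_rpow_norm hn).integrable_smul_right_of_hasCompactSupport
        hΔ hΔc).norm
    · filter_upwards [hne] with x hx
      have : 0 < ‖x‖ := norm_pos_iff.2 hx
      refine Tendsto.mul_const _ ?_
      have h1 : Tendsto (fun ε : ℝ => ‖x‖ ^ 2 + ε ^ 2) (𝓝[>] 0) (𝓝 (‖x‖ ^ 2)) := by
        simpa using (hid.pow 2).const_add (‖x‖ ^ 2)
      exact h1.rpow_const (Or.inl (by positivity))
  obtain ⟨C, hC⟩ := hφ.continuous.bounded_above_of_compact_support hc
  have hR : Tendsto (fun ε : ℝ => -((n : ℝ) - 2) *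
      ∫ x : EuclideanSpace ℝ (Fin n), n * (1 + ‖x‖ ^ 2) ^ (s - 2) * φ (ε • x)) (𝓝[>] 0)
      (𝓝 (-((n : ℝ) - 2) *
        ∫ x : EuclideanSpace ℝ (Fin n), n * (1 + ‖x‖ ^ 2) ^ (s - 2) * φ 0)) := by
    refine Tendsto.const_mul _ ?_
    refine tendsto_integral_filter_of_dominated_convergence
      (fun x => n * (1 + ‖x‖ ^ 2) ^ (s - 2) * C) ?_ ?_ ?_ ?_
    · refine Eventually.of_forall fun ε => Continuous.aestronglyMeasurable ?_
      refine Continuous.mul (Continuous.mul continuous_const ?_)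
        (hφ.continuous.comp (continuous_const_smul ε))
      exact Continuous.rpow_const (by fun_prop) fun x => Or.inl (by positivity)
    · refine Eventually.of_forall fun ε => Eventually.of_forall fun x => ?_
      rw [norm_mul, Real.norm_of_nonneg (by positivity)]
      gcongr
      exact hC _
    · exact (integrable_radial_bump (by omega)).mul_const C
    · refine Eventually.of_forall fun x => Tendsto.const_mul _ ?_
      have h1 : Tendsto (fun ε : ℝ => ε • x) (𝓝[>] 0) (𝓝 0) := by
        simpa using hid.smul_const x
      exact (hφ.continuous.tendsto 0).comp h1
  have heq : (fun ε : ℝ => ∫ x, (‖x‖ ^ 2 + ε ^ 2) ^ s * Δ φ x) =ᶠ[𝓝[>] 0] fun ε : ℝ =>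
      -((n : ℝ) - 2) *
        ∫ x : EuclideanSpace ℝ (Fin n), n * (1 + ‖x‖ ^ 2) ^ (s - 2) * φ (ε • x) := by
    filter_upwards [hev] with ε hε
    exact integral_regularized_mul_laplacian hn hφ hc hε
  rw [tendsto_nhds_unique hL (hR.congr' heq.symm), integral_mul_const,
    integral_radial_bump (by omega)]
  ring

lemma laplacian_comp_add_right {E : Type*} [NormedAddCommGroup E] [InnerProductSpace ℝ E]
    [FiniteDimensional ℝ E] (φ : E → ℝ) (y x : E) :
    Δ (fun z => φ (z + y) : E → ℝ) x = Δ φ (x + y) := by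
  rw [InnerProductSpace.laplacian_eq_iteratedFDeriv_stdOrthonormalBasis,
    InnerProductSpace.laplacian_eq_iteratedFDeriv_stdOrthonormalBasis]
  simp [iteratedFDeriv_comp_add_right]

/-- The Newtonian kernel satisfies `-Δ N(·, y) = δ_y` on `ℝⁿ`. -/
lemma integral_newtonKernel_mul_laplacian (hn : 3 ≤ n) {φ : EuclideanSpace ℝ (Fin n) → ℝ}
    (hφ : ContDiff ℝ 2 φ) (hc : HasCompactSupport φ) (y : EuclideanSpace ℝ (Fin n)) :
    ∫ x, newtonKernel n x y * (-(Δ φ x)) = φ y := by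
  have hn' : (3 : ℝ) ≤ n := by exact_mod_cast hn
  have hω := sphereArea_pos (n := n) (by omega)
  have h2 : (0 : ℝ) < n - 2 := by linarith
  have hφ' : ContDiff ℝ 2 (fun z => φ (z + y)) := hφ.comp (contDiff_id.add contDiff_const)
  have hc' : HasCompactSupport (fun z => φ (z + y)) :=
    hc.comp_homeomorph (Homeomorph.addRight y)
  have h := integral_rpow_norm_mul_laplacian hn hφ' hc'
  simp_rw [laplacian_comp_add_right, zero_add] at h
  rw [← integral_add_right_eq_self _ y]
  simp_rw [newtonKernel_eq hn, add_sub_cancel_right, mul_neg, mul_assoc]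
  rw [integral_neg, integral_const_mul, h]
  field_simp

end NewtonKernel

/-! ### The weak maximum principle. -/

section MaximumPrinciple

variable {E : Type*} [NormedAddCommGroup E] [InnerProductSpace ℝ E]

/-- Restrict to a line. A positive second derivative would make the point a local minimum as well,
so the restriction would be locally constant and its second derivative zero. -/
lemma IsLocalMax.fderiv_fderiv_apply_nonpos {f : E → ℝ} {x : E} (h : IsLocalMax f x)
    (hf : ContDiffAt ℝ 2 f x) (v : E) :
    fderiv ℝ (fun z => fderiv ℝ f z v) x v ≤ 0 := by
  by_contra! hpos
  set l : ℝ → E := fun t => x + t • v with hl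
  have hld (t : ℝ) : HasDerivAt l v t := by
    exact (((hasDerivAt_id t).smul_const v).const_add x).congr_deriv (one_smul ℝ v)
  have hl0 : l 0 = x := by simp [hl]
  have hlc : Tendsto l (𝓝 0) (𝓝 x) := by
    have := (hld 0).continuousAt.tendsto
    rwa [hl0] at this
  have hnear : ∀ᶠ z in 𝓝 x, DifferentiableAt ℝ f z :=
    (hf.eventually (by simp)).mono fun z hz => hz.differentiableAt (by norm_num)
  have hd1 : deriv (f ∘ l) =ᶠ[𝓝 0] fun t => fderiv ℝ f (l t) v := by
    filter_upwards [hlc.eventually hnear] with t ht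
    exact (ht.hasFDerivAt.comp_hasDerivAt t (hld t)).deriv
  have hdd : DifferentiableAt ℝ (fun z => fderiv ℝ f z v) x :=
    ((hf.fderiv_right (m := 1) (by norm_num)).clm_apply contDiffAt_const).differentiableAt
      (by norm_num)
  have hd2 : deriv (deriv (f ∘ l)) 0 = fderiv ℝ (fun z => fderiv ℝ f z v) x v := by
    rw [hd1.deriv_eq]
    rw [← hl0] at hdd
    have := (hdd.hasFDerivAt.comp_hasDerivAt 0 (hld 0)).deriv
    rwa [hl0] at this
  have hmax : IsLocalMax (f ∘ l) 0 := by
    have : IsLocalMax f (l 0) := by rwa [hl0]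
    filter_upwards [hlc.eventually h] with t ht
    simpa [hl0] using ht
  have hcont : ContinuousAt (f ∘ l) 0 := by
    refine ContinuousAt.comp ?_ (hld 0).continuousAt
    rw [hl0]
    exact hf.continuousAt
  have hmin : IsLocalMin (f ∘ l) 0 :=
    isLocalMin_of_deriv_deriv_pos (by rw [hd2]; exact hpos) hmax.deriv_eq_zero hcont
  have hconst : f ∘ l =ᶠ[𝓝 0] fun _ => (f ∘ l) 0 := by
    filter_upwards [hmax, hmin] with t h1 h2
    exact le_antisymm h1 h2
  have h0 : deriv (f ∘ l) =ᶠ[𝓝 0] fun _ => 0 := by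
    simpa using hconst.deriv
  have := h0.deriv_eq
  rw [hd2] at this
  simp at this
  exact hpos.ne' this

variable [FiniteDimensional ℝ E]

lemma IsLocalMax.laplacian_nonpos {f : E → ℝ} {x : E} (h : IsLocalMax f x)
    (hf : ContDiffAt ℝ 2 f x) : Δ f x ≤ 0 := by
  rw [laplacian_eq_sum_fderiv_fderiv (stdOrthonormalBasis ℝ E) hf]
  exact Finset.sum_nonpos fun i _ => h.fderiv_fderiv_apply_nonpos hf _

/-- The weak maximum principle on a compact set `K`. -/
lemma le_of_laplacian_eq_zero [Nontrivial E] {K : Set E} (hK : IsCompact K) {v : E → ℝ} {M : ℝ}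
    (hv : ∀ x ∈ K, ContDiffAt ℝ 2 v x) (hΔ : ∀ x ∈ interior K, Δ v x = 0)
    (hM : ∀ x ∈ K, x ∉ interior K → v x ≤ M) {x : E} (hx : x ∈ K) : v x ≤ M := by
  by_contra! hlt
  obtain ⟨R, hR0, hR⟩ : ∃ R : ℝ, 0 < R ∧ ∀ z ∈ K, ‖z‖ ^ 2 + 1 ≤ R := by
    obtain ⟨r, hr⟩ := hK.isBounded.subset_closedBall 0
    refine ⟨r ^ 2 + 1, by positivity, fun z hz => ?_⟩
    have : ‖z‖ ≤ r := by simpa using hr hz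
    gcongr
  -- The perturbation η(|z|²+1) is at most half the gap v(x) - M on K, so the maximum of the
  -- perturbed function cannot be at a point where v ≤ M; its Laplacian 2ηd > 0 excludes an interior
  -- maximum.
  set η : ℝ := (v x - M) / (2 * R) with hη
  have hη0 : 0 < η := div_pos (by linarith) (by linarith)
  set q : E → ℝ := fun z => (1 * ‖z‖ ^ 2 - 2 * inner ℝ z (0 : E) + 1) ^ (1 : ℝ) with hq
  have hqz (z : E) : q z = ‖z‖ ^ 2 + 1 := by simp [hq]
  have hpos (z : E) : 0 < 1 * ‖z‖ ^ 2 - 2 * inner ℝ z (0 : E) + 1 := by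
    rw [inner_zero_right]
    have := sq_nonneg ‖z‖
    linarith
  have hqc (z : E) : ContDiffAt ℝ 2 q z :=
    (contDiffAt_rpow_quadratic 1 1 1 0 z (hpos z)).of_le two_le_infty
  have hqΔ (z : E) : Δ q z = 2 * Module.finrank ℝ E := by
    rw [hq, laplacian_rpow_quadratic 1 1 1 0 z (hpos z)]
    simp
  have hηq (z : E) : ContDiffAt ℝ 2 (η • q) z := contDiffAt_const.smul (hqc z)
  have hwc (z : E) (hz : z ∈ K) : ContDiffAt ℝ 2 (v + η • q) z :=
    (hv z hz).add (hηq z)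
  obtain ⟨z, hz, hmax⟩ := hK.exists_isMaxOn ⟨x, hx⟩
    (fun z hz => (hwc z hz).continuousAt.continuousWithinAt)
  have h1 : (v + η • q) x ≤ (v + η • q) z := hmax hx
  simp only [Pi.add_apply, Pi.smul_apply, smul_eq_mul, hqz] at h1
  have h2 : η * (‖z‖ ^ 2 + 1) ≤ η * R := by
    gcongr
    exact hR z hz
  have h3 : η * R = (v x - M) / 2 := by
    rw [hη]; field_simp
  have h4 : 0 < η * (‖x‖ ^ 2 + 1) := by positivity
  by_cases hzi : z ∈ interior K
  · have hloc : IsLocalMax (v + η • q) z := by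
      filter_upwards [mem_interior_iff_mem_nhds.1 hzi] with y hy
      exact hmax hy
    have h5 := hloc.laplacian_nonpos (hwc z hz)
    rw [(hv z hz).laplacian_add (hηq z), hΔ z hzi,
      InnerProductSpace.laplacian_smul η (hqc z), hqΔ] at h5
    have : (0 : ℝ) < Module.finrank ℝ E := by exact_mod_cast Module.finrank_pos
    simp only [smul_eq_mul, zero_add] at h5
    have : 0 < η * (2 * Module.finrank ℝ E) := by positivity
    linarith
  · have := hM z hz hzi
    linarith

/-- The weak maximum principle for the absolute value. -/
lemma abs_le_of_laplacian_eq_zero [Nontrivial E] {K : Set E} (hK : IsCompact K) {v : E → ℝ} {M : ℝ}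
    (hv : ∀ x ∈ K, ContDiffAt ℝ 2 v x) (hΔ : ∀ x ∈ interior K, Δ v x = 0)
    (hM : ∀ x ∈ K, x ∉ interior K → |v x| ≤ M) {x : E} (hx : x ∈ K) : |v x| ≤ M := by
  refine abs_le.2 ⟨?_, le_of_laplacian_eq_zero hK hv hΔ (fun z hz hzi => (abs_le.1 (hM z hz hzi)).2)
    hx⟩
  have h := le_of_laplacian_eq_zero (v := -v) (M := M) hK (fun z hz => (hv z hz).neg)
    (fun z hz => by
      rw [InnerProductSpace.laplacian_neg]
      simp [hΔ z hz])
    (fun z hz hzi => by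
      have := (abs_le.1 (hM z hz hzi)).1
      simp only [Pi.neg_apply]
      linarith) hx
  simp only [Pi.neg_apply] at h
  linarith

lemma laplacian_comp_const_sub {ρ : E → ℝ} (hρ : ContDiff ℝ 2 ρ) (c z : E) :
    Δ (fun z => ρ (c - z) : E → ℝ) z = Δ ρ (c - z) := by
  have hsub (z : E) : HasFDerivAt (fun z : E => c - z) (-ContinuousLinearMap.id ℝ E) z :=
    (hasFDerivAt_id z).const_sub c
  have h1 (f : E → ℝ) (hf : Differentiable ℝ f) (v z : E) :
      fderiv ℝ (fun z => f (c - z)) z v = -fderiv ℝ f (c - z) v := by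
    have := ((hf (c - z)).hasFDerivAt.comp z (hsub z)).fderiv
    simp only [Function.comp_def] at this
    rw [this]
    simp
  have hd (v : E) : Differentiable ℝ (fun t => fderiv ℝ ρ t v) :=
    ((hρ.fderiv_right (m := 1) (by norm_num)).clm_apply contDiff_const).differentiable
      (by norm_num)
  have hc : ContDiff ℝ 2 (fun z => ρ (c - z)) := hρ.comp (contDiff_const.sub contDiff_id)
  rw [laplacian_eq_sum_fderiv_fderiv (stdOrthonormalBasis ℝ E) hρ.contDiffAt,
    laplacian_eq_sum_fderiv_fderiv (stdOrthonormalBasis ℝ E) hc.contDiffAt]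
  refine Finset.sum_congr rfl fun i _ => ?_
  simp_rw [h1 ρ (hρ.differentiable (by norm_num))]
  rw [fderiv_fun_neg, _root_.neg_apply, h1 _ (hd _), neg_neg]

end MaximumPrinciple

/-! ### Differentiating a convolution. -/

section Mollification

variable {E : Type*} [NormedAddCommGroup E] [InnerProductSpace ℝ E] [FiniteDimensional ℝ E]
  [MeasurableSpace E] [BorelSpace E]

open scoped Convolution

lemma fderiv_convolution_left_apply {ρ g : E → ℝ} (hc : HasCompactSupport ρ)
    (hρ : ContDiff ℝ 1 ρ) (hg : LocallyIntegrable g) (x v : E) :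
    fderiv ℝ (ρ ⋆[ContinuousLinearMap.lsmul ℝ ℝ, volume] g) x v =
      ((fun t => fderiv ℝ ρ t v) ⋆[ContinuousLinearMap.lsmul ℝ ℝ, volume] g) x := by
  rw [(hc.hasFDerivAt_convolution_left (ContinuousLinearMap.lsmul ℝ ℝ) hρ hg x).fderiv]
  have h : ConvolutionExistsAt (fderiv ℝ ρ) g x
      ((ContinuousLinearMap.lsmul ℝ ℝ).precompL E) volume :=
    (hc.fderiv ℝ).convolutionExists_left _ (hρ.continuous_fderiv one_ne_zero) hg x
  rw [convolution_def, convolution_def, ContinuousLinearMap.integral_apply h]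
  simp

/-- All derivatives fall on the smooth factor, so the Laplacian of a mollification is a pairing with
Δρ, to which a weak equation can be applied. -/
lemma laplacian_convolution_left {ρ g : E → ℝ} (hc : HasCompactSupport ρ)
    (hρ : ContDiff ℝ ∞ ρ) (hg : LocallyIntegrable g) (x : E) :
    Δ (ρ ⋆[ContinuousLinearMap.lsmul ℝ ℝ, volume] g) x = ∫ z, g z * Δ ρ (x - z) := by
  set b := stdOrthonormalBasis ℝ E
  have hC : ContDiff ℝ ∞ (ρ ⋆[ContinuousLinearMap.lsmul ℝ ℝ, volume] g) :=
    hc.contDiff_convolution_left _ hρ hg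
  have hρ1 (v : E) : ContDiff ℝ ∞ (fun t => fderiv ℝ ρ t v) :=
    (hρ.fderiv_right (m := ∞) (by norm_num)).clm_apply contDiff_const
  have hc1 (v : E) : HasCompactSupport (fun t => fderiv ℝ ρ t v) := hc.fderiv_apply ℝ v
  have hρ2 (v : E) : ContDiff ℝ ∞ (fun t => fderiv ℝ (fun t => fderiv ℝ ρ t v) t v) :=
    ((hρ1 v).fderiv_right (m := ∞) (by norm_num)).clm_apply contDiff_const
  have hc2 (v : E) : HasCompactSupport (fun t => fderiv ℝ (fun t => fderiv ℝ ρ t v) t v) :=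
    (hc1 v).fderiv_apply ℝ v
  have h1le : (1 : WithTop ℕ∞) ≤ ∞ := one_le_two.trans two_le_infty
  rw [laplacian_eq_sum_fderiv_fderiv b (hC.contDiffAt.of_le two_le_infty)]
  have h1 (v : E) : (fun z => fderiv ℝ (ρ ⋆[ContinuousLinearMap.lsmul ℝ ℝ, volume] g) z v) =
      ((fun t => fderiv ℝ ρ t v) ⋆[ContinuousLinearMap.lsmul ℝ ℝ, volume] g) :=
    funext fun z => fderiv_convolution_left_apply hc (hρ.of_le h1le) hg z v
  have h2 (v : E) : fderiv ℝ
      (fun z => fderiv ℝ (ρ ⋆[ContinuousLinearMap.lsmul ℝ ℝ, volume] g) z v) x v =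
      ∫ z, g z * fderiv ℝ (fun t => fderiv ℝ ρ t v) (x - z) v := by
    rw [h1 v, fderiv_convolution_left_apply (hc1 v) ((hρ1 v).of_le h1le) hg x v,
      convolution_eq_swap]
    simp [mul_comm]
  simp_rw [h2]
  rw [← integral_finsetSum]
  · congr 1
    ext z
    rw [laplacian_eq_sum_fderiv_fderiv b (hρ.contDiffAt.of_le two_le_infty), Finset.mul_sum]
  · intro i _
    have h := hg.integrable_smul_right_of_hasCompactSupport
      (g := fun z => fderiv ℝ (fun t => fderiv ℝ ρ t (b i)) (x - z) (b i))
      ((hρ2 (b i)).continuous.comp (continuous_const.sub continuous_id))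
      ((hc2 (b i)).comp_homeomorph (Homeomorph.subLeft x))
    simpa using h

end Mollification

/-! ### Uniqueness for weakly harmonic functions with one exceptional point. -/

section Uniqueness

variable {E : Type*} [NormedAddCommGroup E] [InnerProductSpace ℝ E] [FiniteDimensional ℝ E]
  [MeasurableSpace E] [BorelSpace E]

open scoped Convolution

/-- A weakly harmonic function which is continuous up to the boundary away from one interior point
and vanishes on the boundary is zero away from that point. -/
lemma eq_zero_of_weakly_harmonic [Nontrivial E] {Ω : Set E} (hΩ : IsOpen Ω)
    (hb : Bornology.IsBounded Ω) {u : E → ℝ} {y : E} (hy : y ∈ Ω)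
    (hint : LocallyIntegrableOn u Ω) (hcont : ContinuousOn u (closure Ω \ {y}))
    (h0 : ∀ x ∈ frontier Ω, u x = 0)
    (hweak : ∀ φ : E → ℝ, ContDiff ℝ ∞ φ → HasCompactSupport φ → tsupport φ ⊆ Ω →
      ∫ x in Ω, u x * Δ φ x = 0) {x : E} (hx : x ∈ Ω) (hxy : x ≠ y) : u x = 0 := by
  suffices h : ∀ ε > 0, |u x| ≤ 2 * ε by
    refine abs_eq_zero.1 (le_antisymm (le_of_forall_pos_le_add fun ε hε => ?_) (abs_nonneg _))
    have := h (ε / 2) (by positivity)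
    linarith
  intro ε hε
  obtain ⟨r, hr, hrΩ⟩ : ∃ r > 0, Metric.closedBall y r ⊆ Ω :=
    Metric.nhds_basis_closedBall.mem_iff.1 (hΩ.mem_nhds hy)
  -- `S` is where u is not small, away from the pole. Zero boundary values keep this compact set
  -- inside Ω.
  set S : Set E := (closure Ω \ Metric.ball y r) ∩ u ⁻¹' {t | ε ≤ |t|} with hS
  have hclosed : IsClosed S := by
    refine ContinuousOn.preimage_isClosed_of_isClosed (hcont.mono ?_)
      (isClosed_closure.sdiff Metric.isOpen_ball) (isClosed_le continuous_const continuous_abs)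
    exact sdiff_subset_sdiff_right (singleton_subset_iff.2 (Metric.mem_ball_self hr))
  have hScomp : IsCompact S :=
    hb.isCompact_closure.of_isClosed_subset hclosed fun z hz => hz.1.1
  have hSΩ : S ⊆ Ω := by
    intro z hz
    by_contra hzΩ
    have h1 : u z = 0 := h0 z ⟨hz.1.1, by rwa [hΩ.interior_eq]⟩
    have h2 : ε ≤ |u z| := hz.2
    rw [h1, abs_zero] at h2
    linarith
  set S' : Set E := S ∪ Metric.closedBall y r ∪ {x} with hS'
  have hS'comp : IsCompact S' :=
    (hScomp.union (isCompact_closedBall y r)).union isCompact_singleton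
  have hS'Ω : S' ⊆ Ω :=
    union_subset (union_subset hSΩ hrΩ) (singleton_subset_iff.2 hx)
  -- The maximum principle is run on K₁. The larger K₂ contains every mollification ball centred in
  -- K₁, so that cutting u off outside K₂ changes nothing on K₁.
  obtain ⟨K₁, hK₁, hSK₁, hK₁Ω⟩ := exists_compact_between hS'comp hΩ hS'Ω
  obtain ⟨K₂, hK₂, hK₁K₂, hK₂Ω⟩ := exists_compact_between hK₁ hΩ hK₁Ω
  obtain ⟨δ₁, hδ₁, hδ₁K⟩ := hS'comp.exists_thickening_subset_open isOpen_interior hSK₁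
  obtain ⟨δ₂, hδ₂, hδ₂K⟩ := hK₁.exists_thickening_subset_open isOpen_interior hK₁K₂
  have hux : ContinuousAt u x := by
    refine hcont.continuousAt ?_
    rw [sdiff_eq]
    exact inter_mem (mem_of_superset (hΩ.mem_nhds hx) subset_closure)
      (isOpen_compl_singleton.mem_nhds hxy)
  obtain ⟨δ₃, hδ₃, hδ₃u⟩ := Metric.continuousAt_iff.1 hux ε hε
  set δ : ℝ := min δ₁ (min δ₂ δ₃) with hδ
  have hδ0 : 0 < δ := by positivity
  have hδ1 : δ ≤ δ₁ := min_le_left _ _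
  have hδ2 : δ ≤ δ₂ := (min_le_right _ _).trans (min_le_left _ _)
  have hδ3 : δ ≤ δ₃ := (min_le_right _ _).trans (min_le_right _ _)
  have hball {z : E} (hz : z ∈ K₁) : Metric.ball z δ ⊆ K₂ := by
    refine ((Metric.ball_subset_thickening hz δ).trans
      (Metric.thickening_mono hδ2 K₁)).trans (hδ₂K.trans interior_subset)
  let B : ContDiffBump (0 : E) := ⟨δ / 2, δ, by positivity, by linarith⟩
  set ρ : E → ℝ := B.normed volume with hρ
  have hρs : Function.support ρ ⊆ Metric.ball 0 δ := (B.support_normed_eq).subset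
  have hρc : HasCompactSupport ρ := B.hasCompactSupport_normed
  have hρd : ContDiff ℝ ∞ ρ := B.contDiff_normed
  set g : E → ℝ := K₂.indicator u with hg
  have hgint : Integrable g :=
    (hint.integrableOn_compact_subset hK₂Ω hK₂).integrable_indicator hK₂.measurableSet
  set v : E → ℝ := ρ ⋆[ContinuousLinearMap.lsmul ℝ ℝ, volume] g with hv
  have hvd : ContDiff ℝ ∞ v := hρc.contDiff_convolution_left _ hρd hgint.locallyIntegrable
  have hgu {z : E} (hz : z ∈ K₂) : g z = u z := indicator_of_mem hz u
  -- The translated kernel w ↦ ρ(z - w) is an admissible test function. It may cover the pole, which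
  -- is harmless because the weak equation holds there too.
  have hvΔ (z : E) (hz : z ∈ K₁) : Δ v z = 0 := by
    rw [hv, laplacian_convolution_left hρc hρd hgint.locallyIntegrable]
    have hts : tsupport (fun w => ρ (z - w)) ⊆ K₂ := by
      refine closure_minimal (fun w hw => hball hz ?_) hK₂.isClosed
      have : z - w ∈ Metric.ball (0 : E) δ := hρs hw
      rwa [mem_ball_zero_iff, ← dist_eq_norm, dist_comm] at this
    rw [← hweak (fun w => ρ (z - w)) (hρd.comp (contDiff_const.sub contDiff_id))
      (hρc.comp_homeomorph (Homeomorph.subLeft z)) (hts.trans hK₂Ω),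
      ← integral_indicator hΩ.measurableSet]
    congr 1
    ext w
    rw [← laplacian_comp_const_sub (hρd.of_le two_le_infty)]
    by_cases hw : w ∈ K₂
    · rw [hgu hw, indicator_of_mem (hK₂Ω hw)]
    · have h2 : (fun w => ρ (z - w)) =ᶠ[𝓝 w] fun _ => 0 :=
        notMem_tsupport_iff_eventuallyEq.1 fun h => hw (hts h)
      have h3 := (InnerProductSpace.laplacian_congr_nhds h2).eq_of_nhds
      rw [InnerProductSpace.laplacian_const, Pi.zero_apply] at h3
      simp [indicator, h3]
  -- At a boundary point of K₁ the δ-ball misses `S'`, so v there averages values of u of size less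
  -- than ε.
  have hfar (z : E) (hz : z ∈ K₁) (hzi : z ∉ interior K₁) : |v z| ≤ ε := by
    have := dist_convolution_le (μ := volume) (f := ρ) (g := g) (x₀ := z) (z₀ := (0 : ℝ)) hε.le
      hρs B.nonneg_normed B.integral_normed hgint.aestronglyMeasurable fun w hw => by
        have hwK : w ∈ K₂ := hball hz hw
        have hwS : w ∉ S' := fun hwS => hzi (hδ₁K
          (Metric.thickening_mono hδ1 S' (Metric.mem_thickening_iff.2
            ⟨w, hwS, by rw [dist_comm]; exact hw⟩)))
        rw [hgu hwK, Real.dist_eq, sub_zero]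
        by_contra! hlt
        refine hwS (Or.inl ?_)
        by_cases hwy : w ∈ Metric.ball y r
        · exact Or.inr (Metric.ball_subset_closedBall hwy)
        · exact Or.inl ⟨⟨subset_closure (hK₂Ω hwK), hwy⟩, hlt.le⟩
    simpa [Real.dist_eq] using this
  have hxK₁ : x ∈ K₁ := interior_subset (hSK₁ (Or.inr rfl))
  have h1 : |v x| ≤ ε := abs_le_of_laplacian_eq_zero hK₁
    (fun z _ => hvd.contDiffAt.of_le two_le_infty) (fun z hz => hvΔ z (interior_subset hz)) hfar hxK₁
  have h2 : |v x - u x| ≤ ε := by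
    have := dist_convolution_le (μ := volume) (f := ρ) (g := g) (x₀ := x) (z₀ := u x) hε.le
      hρs B.nonneg_normed B.integral_normed hgint.aestronglyMeasurable fun w hw => by
        rw [hgu (hball hxK₁ hw)]
        exact (hδ₃u (lt_of_lt_of_le hw hδ3)).le
    simpa [Real.dist_eq] using this
  have h3 : |u x| ≤ |v x| + |v x - u x| := by
    have := abs_sub_abs_le_abs_sub (u x) (v x)
    rw [abs_sub_comm] at this
    linarith
  linarith

end Uniqueness

/-! ### Termwise differentiation of series with a compact parameter. -/

section ParametricSeries

variable {E : Type*} [NormedAddCommGroup E] [NormedSpace ℝ E]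

open scoped Manifold in
lemma exists_contDiff_cutoff [FiniteDimensional ℝ E] {K W : Set E} (hK : IsCompact K)
    (hW : IsOpen W) (hKW : K ⊆ W) : ∃ χ : E → ℝ, ContDiff ℝ ∞ χ ∧ HasCompactSupport χ ∧
      tsupport χ ⊆ W ∧ ∀ᶠ x in 𝓝ˢ K, χ x = 1 := by
  obtain ⟨T, hT, hKT, hTW⟩ := exists_compact_between hK hW hKW
  obtain ⟨f, hf1, hf0, -⟩ :=
    exists_contMDiffMap_one_nhds_of_subset_interior (n := ⊤) 𝓘(ℝ, E) hK.isClosed hKT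
  have hts : tsupport f ⊆ T := closure_minimal
    (fun x hx => by_contra fun hxT => hx (hf0 x hxT)) hT.isClosed
  exact ⟨f, f.contMDiff.contDiff, hT.of_isClosed_subset (isClosed_tsupport _) hts, hts.trans hTW,
    hf1⟩

lemma contDiff_mul_of_tsupport_subset {χ g : E → ℝ} {W : Set E} {k : WithTop ℕ∞} (hW : IsOpen W)
    (hχ : ContDiff ℝ k χ) (hs : tsupport χ ⊆ W) (hg : ContDiffOn ℝ k g W) :
    ContDiff ℝ k fun x => χ x * g x := by
  rw [contDiff_iff_contDiffAt]
  intro x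
  by_cases hx : x ∈ tsupport χ
  · exact hχ.contDiffAt.mul (hg.contDiffAt (hW.mem_nhds (hs hx)))
  · have h : (fun x => χ x * g x) =ᶠ[𝓝 x] fun _ => 0 := by
      filter_upwards [notMem_tsupport_iff_eventuallyEq.1 hx] with z hz
      simp [hz]
    exact contDiffAt_const.congr_of_eventuallyEq h

/-- Slices of a smooth compactly supported function have uniformly bounded derivatives. -/
lemma exists_bound_iteratedFDeriv_slice {Φ : ℝ × E → ℝ} (hΦ : ContDiff ℝ ∞ Φ)
    (hc : HasCompactSupport Φ) (k : ℕ) :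
    ∃ C, ∀ l q, ‖iteratedFDeriv ℝ k (fun q => Φ (l, q)) q‖ ≤ C := by
  obtain ⟨C, hC⟩ := (hΦ.continuous_iteratedFDeriv (m := k)
    (by exact_mod_cast le_top)).bounded_above_of_compact_support (hc.iteratedFDeriv k)
  set I := ContinuousLinearMap.inr ℝ ℝ E
  have hC0 : 0 ≤ C := (norm_nonneg _).trans (hC 0)
  refine ⟨C * ∏ _i : Fin k, ‖I‖, fun l q => ?_⟩
  have h1 : (fun q => Φ (l, q)) = (fun z => Φ (z + (l, 0))) ∘ I := by
    ext q
    simp [I]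
  have h2 : ContDiff ℝ ∞ fun z => Φ (z + (l, 0)) := hΦ.comp (contDiff_id.add contDiff_const)
  rw [h1, I.iteratedFDeriv_comp_right h2 q (i := k) (by exact_mod_cast le_top),
    iteratedFDeriv_comp_add_right]
  refine (ContinuousMultilinearMap.norm_compContinuousLinearMap_le _ _).trans ?_
  gcongr
  exact hC _

/-- A series `∑ w_j g(l_j, ·)` with summable weights and parameters in `[0, 1]` may be
differentiated termwise. -/
lemma contDiffAt_tsum_param [FiniteDimensional ℝ E] {W : Set (ℝ × E)} (hW : IsOpen W)
    {g : ℝ × E → ℝ} (hg : ContDiffOn ℝ ∞ g W) {w l : ℕ → ℝ} (hw : Summable fun j => |w j|)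
    (hl : ∀ j, l j ∈ Icc (0 : ℝ) 1) {p : E} (hp : Icc (0 : ℝ) 1 ×ˢ {p} ⊆ W) :
    ContDiffAt ℝ ∞ (fun q => ∑' j, w j * g (l j, q)) p ∧
      ∀ k : ℕ, Summable (fun j => iteratedFDeriv ℝ k (fun q => w j * g (l j, q)) p) ∧
        iteratedFDeriv ℝ k (fun q => ∑' j, w j * g (l j, q)) p =
          ∑' j, iteratedFDeriv ℝ k (fun q => w j * g (l j, q)) p := by
  -- Multiplying by a cutoff equal to 1 near [0,1] × {p} makes g compactly supported, so each order
  -- of derivative is bounded uniformly in the parameter.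
  obtain ⟨χ, hχ, hχc, hχW, hχ1⟩ :=
    exists_contDiff_cutoff (isCompact_Icc.prod isCompact_singleton) hW hp
  have hΦ := contDiff_mul_of_tsupport_subset hW hχ hχW hg
  set Φ : ℝ × E → ℝ := fun z => χ z * g z with hΦdef
  have hΦc : HasCompactSupport Φ := hχc.mul_right
  choose C hC using exists_bound_iteratedFDeriv_slice hΦ hΦc
  have hslice (j : ℕ) : ContDiff ℝ ∞ (fun q => Φ (l j, q)) :=
    hΦ.comp (contDiff_const.prodMk contDiff_id)
  have hd (j : ℕ) : ContDiff ℝ ∞ (fun q => w j * Φ (l j, q)) := contDiff_const.mul (hslice j)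
  have hbound (k j : ℕ) (q : E) :
      ‖iteratedFDeriv ℝ k (fun q => w j * Φ (l j, q)) q‖ ≤ |w j| * C k := by
    have := iteratedFDeriv_const_smul_apply (𝕜 := ℝ) (i := k) (a := w j)
      (f := fun q => Φ (l j, q)) (x := q)
      ((hslice j).contDiffAt.of_le (by exact_mod_cast le_top))
    have h2 : (w j • fun q => Φ (l j, q)) = fun q => w j * Φ (l j, q) := by
      ext q; simp
    rw [h2] at this
    rw [this, norm_smul, Real.norm_eq_abs]
    gcongr
    exact hC k _ _
  have hsum (k : ℕ) : Summable fun j => |w j| * C k := hw.mul_right _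
  have hN : ∀ᶠ q in 𝓝 p, ∀ t ∈ Icc (0 : ℝ) 1, χ (t, q) = 1 := by
    -- By the tube lemma one neighbourhood of p serves all parameters, so the cutoff disappears from
    -- all terms simultaneously.
    obtain ⟨U, hU, hKU, hU1⟩ := eventually_nhdsSet_iff_exists.1 hχ1
    obtain ⟨u, v, hu, hv, hKu, hpv, huv⟩ :=
      generalized_tube_lemma isCompact_Icc isCompact_singleton hU hKU
    filter_upwards [hv.mem_nhds (hpv rfl)] with q hq t ht
    exact hU1 _ (huv ⟨hKu ht, hq⟩)
  have hterm (j : ℕ) : (fun q => w j * g (l j, q)) =ᶠ[𝓝 p] fun q => w j * Φ (l j, q) := by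
    filter_upwards [hN] with q hq
    simp [hΦdef, hq _ (hl j)]
  have hser : (fun q => ∑' j, w j * g (l j, q)) =ᶠ[𝓝 p] fun q => ∑' j, w j * Φ (l j, q) := by
    filter_upwards [hN] with q hq
    simp [hΦdef, hq _ (hl _)]
  refine ⟨?_, fun k => ⟨?_, ?_⟩⟩
  · refine ContDiffAt.congr_of_eventuallyEq (ContDiff.contDiffAt ?_) hser
    exact contDiff_tsum (N := ⊤) (v := fun k j => |w j| * C k) hd (fun k _ => hsum k)
      fun k j q _ => hbound k j q
  · simp_rw [fun j => ((hterm j).iteratedFDeriv ℝ k).eq_of_nhds]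
    exact Summable.of_norm_bounded (hsum k) fun j => hbound k j p
  · simp_rw [fun j => ((hterm j).iteratedFDeriv ℝ k).eq_of_nhds]
    rw [(hser.iteratedFDeriv ℝ k).eq_of_nhds]
    exact iteratedFDeriv_tsum_apply (N := ⊤) (v := fun k j => |w j| * C k) hd (fun k _ => hsum k)
      (fun k j q _ => hbound k j q) le_top p

end ParametricSeries

section HarmonicSeries

variable {E : Type*} [NormedAddCommGroup E] [InnerProductSpace ℝ E] [FiniteDimensional ℝ E]

lemma laplacian_tsum_param {W : Set (ℝ × E)} (hW : IsOpen W)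
    {g : ℝ × E → ℝ} (hg : ContDiffOn ℝ ∞ g W) {w l : ℕ → ℝ} (hw : Summable fun j => |w j|)
    (hl : ∀ j, l j ∈ Icc (0 : ℝ) 1) {p : E} (hp : Icc (0 : ℝ) 1 ×ˢ {p} ⊆ W) :
    Δ (fun q => ∑' j, w j * g (l j, q) : E → ℝ) p =
      ∑' j, Δ (fun q => w j * g (l j, q) : E → ℝ) p := by
  obtain ⟨hs, he⟩ := (contDiffAt_tsum_param hW hg hw hl hp).2 2
  set b := stdOrthonormalBasis ℝ E
  have hL (f : E → ℝ) : Δ f p = ∑ i, iteratedFDeriv ℝ 2 f p ![b i, b i] := by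
    rw [InnerProductSpace.laplacian_eq_iteratedFDeriv_orthonormalBasis f b]
  have happ (v : Fin 2 → E) : HasSum
      (fun j => iteratedFDeriv ℝ 2 (fun q => w j * g (l j, q)) p v)
      ((∑' j, iteratedFDeriv ℝ 2 (fun q => w j * g (l j, q)) p) v) :=
    ContinuousMultilinearMap.hasSum_eval hs.hasSum v
  have hsum := hasSum_sum (s := Finset.univ) fun i _ => happ ![b i, b i]
  rw [hL, he, ← hsum.tsum_eq]
  exact tsum_congr fun j => (hL _).symm

end HarmonicSeries

/-! ### The image charges of the annulus. -/

section ImageSeries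

variable {n : ℕ} {a l : ℝ} {x y : EuclideanSpace ℝ (Fin n)}

/-- `l² |x|² |y|² - 2 l ⟨x, y⟩ + 1`. -/
noncomputable def outerQuad (l : ℝ) (x y : EuclideanSpace ℝ (Fin n)) : ℝ :=
  l ^ 2 * ‖y‖ ^ 2 * ‖x‖ ^ 2 - 2 * (l * inner ℝ x y) + 1

/-- `|y - l x|²`. -/
noncomputable def shiftQuad (l : ℝ) (x y : EuclideanSpace ℝ (Fin n)) : ℝ :=
  l ^ 2 * ‖x‖ ^ 2 - 2 * (l * inner ℝ x y) + ‖y‖ ^ 2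

/-- `|x|² |y|² - 2 l ⟨x, y⟩ + l²`. -/
noncomputable def innerQuad (l : ℝ) (x y : EuclideanSpace ℝ (Fin n)) : ℝ :=
  ‖y‖ ^ 2 * ‖x‖ ^ 2 - 2 * (l * inner ℝ x y) + l ^ 2

/-- A group of four image charges of the annulus; `l` runs through the powers of `a²`. -/
noncomputable def imageTerm (n : ℕ) (a l : ℝ) (x y : EuclideanSpace ℝ (Fin n)) : ℝ :=
  outerQuad l x y ^ (-(((n : ℝ) - 2) / 2))
    - a ^ (n - 2) * (shiftQuad (a ^ 2 * l) x y ^ (-(((n : ℝ) - 2) / 2))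
      + shiftQuad (a ^ 2 * l) y x ^ (-(((n : ℝ) - 2) / 2)))
    + a ^ (n - 2) * innerQuad (a ^ 2 * l) x y ^ (-(((n : ℝ) - 2) / 2))

/-- The sum over all image charges of the annulus. -/
noncomputable def imageSeries (n : ℕ) (a : ℝ) (x y : EuclideanSpace ℝ (Fin n)) : ℝ :=
  ∑' j : ℕ, (a ^ (n - 2)) ^ j * imageTerm n a (a ^ (2 * j)) x y

/-- The configurations `(l, x, y)` in which no image charge is hit. -/
def imageDomain (n : ℕ) (a : ℝ) :
    Set (ℝ × (EuclideanSpace ℝ (Fin n) × EuclideanSpace ℝ (Fin n))) :=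
  {z | 0 < outerQuad z.1 z.2.1 z.2.2 ∧ 0 < shiftQuad (a ^ 2 * z.1) z.2.1 z.2.2 ∧
    0 < shiftQuad (a ^ 2 * z.1) z.2.2 z.2.1 ∧ 0 < innerQuad (a ^ 2 * z.1) z.2.1 z.2.2}

lemma outerQuad_comm : outerQuad l x y = outerQuad l y x := by
  rw [outerQuad, outerQuad, real_inner_comm]; ring

lemma innerQuad_comm : innerQuad l x y = innerQuad l y x := by
  rw [innerQuad, innerQuad, real_inner_comm]; ring

lemma imageTerm_comm : imageTerm n a l x y = imageTerm n a l y x := by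
  rw [imageTerm, imageTerm, outerQuad_comm, innerQuad_comm]; ring

lemma imageSeries_comm : imageSeries n a x y = imageSeries n a y x := by
  simp_rw [imageSeries, imageTerm_comm (x := x)]

lemma contDiff_outerQuad : ContDiff ℝ ∞
    fun z : ℝ × (EuclideanSpace ℝ (Fin n) × EuclideanSpace ℝ (Fin n)) =>
      outerQuad z.1 z.2.1 z.2.2 := by
  have h1 : ContDiff ℝ ∞ fun x : EuclideanSpace ℝ (Fin n) => ‖x‖ ^ 2 := contDiff_norm_sq ℝ
  have h2 : ContDiff ℝ ∞ fun z : ℝ × (EuclideanSpace ℝ (Fin n) × EuclideanSpace ℝ (Fin n)) =>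
      inner ℝ z.2.1 z.2.2 := contDiff_snd.fst.inner ℝ contDiff_snd.snd
  exact ((((contDiff_fst.pow 2).mul (h1.comp contDiff_snd.snd)).mul (h1.comp contDiff_snd.fst)).sub
    (contDiff_const.mul (contDiff_fst.mul h2))).add contDiff_const

lemma contDiff_shiftQuad : ContDiff ℝ ∞
    fun z : ℝ × (EuclideanSpace ℝ (Fin n) × EuclideanSpace ℝ (Fin n)) =>
      shiftQuad z.1 z.2.1 z.2.2 := by
  have h1 : ContDiff ℝ ∞ fun x : EuclideanSpace ℝ (Fin n) => ‖x‖ ^ 2 := contDiff_norm_sq ℝ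
  have h2 : ContDiff ℝ ∞ fun z : ℝ × (EuclideanSpace ℝ (Fin n) × EuclideanSpace ℝ (Fin n)) =>
      inner ℝ z.2.1 z.2.2 := contDiff_snd.fst.inner ℝ contDiff_snd.snd
  exact (((contDiff_fst.pow 2).mul (h1.comp contDiff_snd.fst)).sub
    (contDiff_const.mul (contDiff_fst.mul h2))).add (h1.comp contDiff_snd.snd)

lemma contDiff_innerQuad : ContDiff ℝ ∞
    fun z : ℝ × (EuclideanSpace ℝ (Fin n) × EuclideanSpace ℝ (Fin n)) =>
      innerQuad z.1 z.2.1 z.2.2 := by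
  have h1 : ContDiff ℝ ∞ fun x : EuclideanSpace ℝ (Fin n) => ‖x‖ ^ 2 := contDiff_norm_sq ℝ
  have h2 : ContDiff ℝ ∞ fun z : ℝ × (EuclideanSpace ℝ (Fin n) × EuclideanSpace ℝ (Fin n)) =>
      inner ℝ z.2.1 z.2.2 := contDiff_snd.fst.inner ℝ contDiff_snd.snd
  exact (((h1.comp contDiff_snd.snd).mul (h1.comp contDiff_snd.fst)).sub
    (contDiff_const.mul (contDiff_fst.mul h2))).add (contDiff_fst.pow 2)

lemma contDiff_shiftQuad_mul (c : ℝ) : ContDiff ℝ ∞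
    fun z : ℝ × (EuclideanSpace ℝ (Fin n) × EuclideanSpace ℝ (Fin n)) =>
      shiftQuad (c * z.1) z.2.1 z.2.2 :=
  contDiff_shiftQuad.comp ((contDiff_const.mul contDiff_fst).prodMk contDiff_snd)

lemma contDiff_shiftQuad_mul_swap (c : ℝ) : ContDiff ℝ ∞
    fun z : ℝ × (EuclideanSpace ℝ (Fin n) × EuclideanSpace ℝ (Fin n)) =>
      shiftQuad (c * z.1) z.2.2 z.2.1 :=
  contDiff_shiftQuad.comp ((contDiff_const.mul contDiff_fst).prodMk
    (contDiff_snd.snd.prodMk contDiff_snd.fst))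

lemma contDiff_innerQuad_mul (c : ℝ) : ContDiff ℝ ∞
    fun z : ℝ × (EuclideanSpace ℝ (Fin n) × EuclideanSpace ℝ (Fin n)) =>
      innerQuad (c * z.1) z.2.1 z.2.2 :=
  contDiff_innerQuad.comp ((contDiff_const.mul contDiff_fst).prodMk contDiff_snd)

lemma isOpen_imageDomain : IsOpen (imageDomain n a) :=
  (isOpen_lt continuous_const contDiff_outerQuad.continuous).inter
    ((isOpen_lt continuous_const (contDiff_shiftQuad_mul (a ^ 2)).continuous).inter
      ((isOpen_lt continuous_const (contDiff_shiftQuad_mul_swap (a ^ 2)).continuous).inter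
        (isOpen_lt continuous_const (contDiff_innerQuad_mul (a ^ 2)).continuous)))

lemma contDiffOn_imageTerm : ContDiffOn ℝ ∞
    (fun z : ℝ × (EuclideanSpace ℝ (Fin n) × EuclideanSpace ℝ (Fin n)) =>
      imageTerm n a z.1 z.2.1 z.2.2) (imageDomain n a) := by
  have h1 := contDiff_outerQuad.contDiffOn.rpow_const_of_ne (p := -(((n : ℝ) - 2) / 2))
    (s := imageDomain n a) fun z hz => hz.1.ne'
  have h2 := (contDiff_shiftQuad_mul (a ^ 2)).contDiffOn.rpow_const_of_ne
    (p := -(((n : ℝ) - 2) / 2)) (s := imageDomain n a) fun z hz => hz.2.1.ne'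
  have h3 := (contDiff_shiftQuad_mul_swap (a ^ 2)).contDiffOn.rpow_const_of_ne
    (p := -(((n : ℝ) - 2) / 2)) (s := imageDomain n a) fun z hz => hz.2.2.1.ne'
  have h4 := (contDiff_innerQuad_mul (a ^ 2)).contDiffOn.rpow_const_of_ne
    (p := -(((n : ℝ) - 2) / 2)) (s := imageDomain n a) fun z hz => hz.2.2.2.ne'
  exact (h1.sub (contDiffOn_const.mul (h2.add h3))).add (contDiffOn_const.mul h4)

lemma quadratic_inner_pos {p q t : ℝ} (hlt : p < q) (ht : t ≤ p * q) :
    0 < p ^ 2 - 2 * t + q ^ 2 := by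
  nlinarith [sq_pos_of_pos (sub_pos.2 hlt)]

/-- By Cauchy–Schwarz each of the four quadratics is at least (q - p)², where p < q follows from the
bounds on the norms and on l. The point x may lie on the boundary; strictness comes from y. -/
lemma mem_imageDomain (ha0 : 0 < a) (ha1 : a < 1) (hl : l ∈ Icc (0 : ℝ) 1) (hx : a ≤ ‖x‖)
    (hx1 : ‖x‖ ≤ 1) (hy : a < ‖y‖) (hy1 : ‖y‖ < 1) : (l, x, y) ∈ imageDomain n a := by
  obtain ⟨hl0, hl1⟩ := hl
  have hi : inner ℝ x y ≤ ‖x‖ * ‖y‖ := real_inner_le_norm x y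
  have hm0 : 0 ≤ a ^ 2 * l := by positivity
  have hm1 : a ^ 2 * l ≤ a ^ 2 := mul_le_of_le_one_right (by positivity) hl1
  have ha2 : a ^ 2 < a := by nlinarith
  have hx0 : 0 < ‖x‖ := ha0.trans_le hx
  have hy0 : 0 < ‖y‖ := ha0.trans hy
  have hil : l * inner ℝ x y ≤ l * (‖x‖ * ‖y‖) := by gcongr
  have him : a ^ 2 * l * inner ℝ x y ≤ a ^ 2 * l * (‖x‖ * ‖y‖) := by gcongr
  refine ⟨?_, ?_, ?_, ?_⟩
  · have h1 : l * (‖x‖ * ‖y‖) < 1 := by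
      have : ‖x‖ * ‖y‖ ≤ ‖y‖ := mul_le_of_le_one_left hy0.le hx1
      have : l * (‖x‖ * ‖y‖) ≤ ‖x‖ * ‖y‖ := mul_le_of_le_one_left (by positivity) hl1
      linarith
    have := quadratic_inner_pos (p := l * (‖x‖ * ‖y‖)) (q := 1) (t := l * inner ℝ x y)
      h1 (by linarith)
    simp only [outerQuad]
    linarith
  · have h1 : a ^ 2 * l * ‖x‖ < ‖y‖ := by
      have : a ^ 2 * l * ‖x‖ ≤ a ^ 2 * l := mul_le_of_le_one_right hm0 hx1
      linarith
    have := quadratic_inner_pos (t := a ^ 2 * l * inner ℝ x y) h1 (by linarith)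
    simp only [shiftQuad]
    linarith
  · have h1 : a ^ 2 * l * ‖y‖ < ‖x‖ := by
      have : a ^ 2 * l * ‖y‖ ≤ a ^ 2 * l := mul_le_of_le_one_right hm0 hy1.le
      linarith
    have := quadratic_inner_pos (t := a ^ 2 * l * inner ℝ x y) h1 (by linarith)
    simp only [shiftQuad]
    rw [real_inner_comm]
    linarith
  · have h1 : a ^ 2 * l < ‖x‖ * ‖y‖ := by
      have : a * a < ‖x‖ * ‖y‖ := mul_lt_mul' hx hy ha0.le hx0
      linarith
    have := quadratic_inner_pos (t := a ^ 2 * l * inner ℝ x y) h1 (by linarith)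
    simp only [innerQuad]
    linarith

lemma summable_imageWeight (hn : 3 ≤ n) (ha0 : 0 < a) (ha1 : a < 1) :
    Summable fun j : ℕ => |(a ^ (n - 2)) ^ j| := by
  simp_rw [abs_pow, abs_of_pos ha0]
  exact summable_geometric_of_lt_one (by positivity) (pow_lt_one₀ ha0.le ha1 (by omega))

lemma pow_two_mul_mem_Icc (ha0 : 0 < a) (ha1 : a < 1) (j : ℕ) :
    a ^ (2 * j) ∈ Icc (0 : ℝ) 1 :=
  ⟨by positivity, pow_le_one₀ ha0.le ha1.le⟩

lemma contDiffAt_imageSeries (hn : 3 ≤ n) (ha0 : 0 < a) (ha1 : a < 1) (hx : a ≤ ‖x‖)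
    (hx1 : ‖x‖ ≤ 1) (hy : a < ‖y‖) (hy1 : ‖y‖ < 1) :
    ContDiffAt ℝ ∞ (Function.uncurry (imageSeries n a)) (x, y) := by
  refine (contDiffAt_tsum_param isOpen_imageDomain contDiffOn_imageTerm
    (summable_imageWeight hn ha0 ha1) (pow_two_mul_mem_Icc ha0 ha1) (p := (x, y)) ?_).1
  rintro ⟨l, p⟩ ⟨hl, rfl⟩
  exact mem_imageDomain ha0 ha1 hl hx hx1 hy hy1

lemma contDiffAt_imageSeries_left (hn : 3 ≤ n) (ha0 : 0 < a) (ha1 : a < 1) (hx : a ≤ ‖x‖)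
    (hx1 : ‖x‖ ≤ 1) (hy : a < ‖y‖) (hy1 : ‖y‖ < 1) :
    ContDiffAt ℝ ∞ (fun x => imageSeries n a x y) x :=
  (contDiffAt_imageSeries hn ha0 ha1 hx hx1 hy hy1).comp x
    (contDiffAt_id.prodMk contDiffAt_const)

lemma summable_imageTerm (hn : 3 ≤ n) (ha0 : 0 < a) (ha1 : a < 1) (hx : a ≤ ‖x‖)
    (hx1 : ‖x‖ ≤ 1) (hy : a < ‖y‖) (hy1 : ‖y‖ < 1) :
    Summable fun j : ℕ => (a ^ (n - 2)) ^ j * imageTerm n a (a ^ (2 * j)) x y := by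
  have h := ((contDiffAt_tsum_param isOpen_imageDomain contDiffOn_imageTerm
    (summable_imageWeight hn ha0 ha1) (pow_two_mul_mem_Icc ha0 ha1) (p := (x, y)) (by
      rintro ⟨l, p⟩ ⟨hl, rfl⟩
      exact mem_imageDomain ha0 ha1 hl hx hx1 hy hy1)).2 0).1
  simpa using (ContinuousMultilinearMap.hasSum_eval h.hasSum 0).summable

lemma harmonicAt_rpow_quadratic_inner {α β γ : ℝ} (h0 : α * γ = β ^ 2 * ‖y‖ ^ 2)
    (hx : 0 < α * ‖x‖ ^ 2 - 2 * (β * inner ℝ x y) + γ) :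
    InnerProductSpace.HarmonicAt (fun z : EuclideanSpace ℝ (Fin n) =>
      (α * ‖z‖ ^ 2 - 2 * (β * inner ℝ z y) + γ) ^ (-(((n : ℝ) - 2) / 2))) x := by
  have h := harmonicAt_rpow_quadratic α γ (β • y) x
    (by rw [norm_smul, mul_pow, Real.norm_eq_abs, sq_abs, h0])
    (by rwa [real_inner_smul_right])
  simpa only [real_inner_smul_right, finrank_euclideanSpace, Fintype.card_fin] using h

/-- As a function of x, each of the four quadratics has zero discriminant. -/
lemma harmonicAt_imageTerm (h : (l, x, y) ∈ imageDomain n a) :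
    InnerProductSpace.HarmonicAt (fun x => imageTerm n a l x y) x := by
  obtain ⟨h1, h2, h3, h4⟩ := h
  have H1 : InnerProductSpace.HarmonicAt
      (fun x => outerQuad l x y ^ (-(((n : ℝ) - 2) / 2))) x :=
    harmonicAt_rpow_quadratic_inner (by ring) h1
  have H2 : InnerProductSpace.HarmonicAt
      (fun x => shiftQuad (a ^ 2 * l) x y ^ (-(((n : ℝ) - 2) / 2))) x :=
    harmonicAt_rpow_quadratic_inner (by ring) h2
  have hs (x : EuclideanSpace ℝ (Fin n)) : shiftQuad (a ^ 2 * l) y x =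
      1 * ‖x‖ ^ 2 - 2 * (a ^ 2 * l * inner ℝ x y) + (a ^ 2 * l) ^ 2 * ‖y‖ ^ 2 := by
    rw [shiftQuad, real_inner_comm]; ring
  have H3 : InnerProductSpace.HarmonicAt
      (fun x => shiftQuad (a ^ 2 * l) y x ^ (-(((n : ℝ) - 2) / 2))) x := by
    simp only [hs] at h3 ⊢
    exact harmonicAt_rpow_quadratic_inner (by ring) h3
  have H4 : InnerProductSpace.HarmonicAt
      (fun x => innerQuad (a ^ 2 * l) x y ^ (-(((n : ℝ) - 2) / 2))) x :=
    harmonicAt_rpow_quadratic_inner (by ring) h4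
  exact (H1.sub ((H2.add H3).const_smul (c := a ^ (n - 2)))).add
    (H4.const_smul (c := a ^ (n - 2)))

lemma laplacian_imageSeries_left (hn : 3 ≤ n) (ha0 : 0 < a) (ha1 : a < 1) (hx : a ≤ ‖x‖)
    (hx1 : ‖x‖ ≤ 1) (hy : a < ‖y‖) (hy1 : ‖y‖ < 1) :
    Δ (fun x => imageSeries n a x y : EuclideanSpace ℝ (Fin n) → ℝ) x = 0 := by
  set j : ℝ × EuclideanSpace ℝ (Fin n) →
    ℝ × (EuclideanSpace ℝ (Fin n) × EuclideanSpace ℝ (Fin n)) := fun z => (z.1, z.2, y) with hj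
  have hjd : ContDiff ℝ ∞ j := contDiff_fst.prodMk (contDiff_snd.prodMk contDiff_const)
  have hmem {l : ℝ} (hl : l ∈ Icc (0 : ℝ) 1) : (l, x, y) ∈ imageDomain n a :=
    mem_imageDomain ha0 ha1 hl hx hx1 hy hy1
  have hpre : Icc (0 : ℝ) 1 ×ˢ {x} ⊆ j ⁻¹' imageDomain n a := by
    rintro ⟨l, p⟩ ⟨hl, hp⟩
    have hp : p = x := hp
    subst hp
    exact hmem hl
  have h := laplacian_tsum_param (isOpen_imageDomain.preimage hjd.continuous)
    (contDiffOn_imageTerm.comp hjd.contDiffOn fun z hz => hz)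
    (summable_imageWeight hn ha0 ha1) (pow_two_mul_mem_Icc ha0 ha1) (p := x) hpre
  refine h.trans ?_
  have h0 (i : ℕ) : Δ (fun q => (a ^ (n - 2)) ^ i * imageTerm n a (a ^ (2 * i)) q y :
      EuclideanSpace ℝ (Fin n) → ℝ) x = 0 :=
    ((harmonicAt_imageTerm (hmem (pow_two_mul_mem_Icc ha0 ha1 i))).const_smul
      (c := (a ^ (n - 2)) ^ i)).2.eq_of_nhds
  exact (tsum_congr h0).trans tsum_zero

lemma harmonicOnNhd_imageSeries_left (hn : 3 ≤ n) (ha0 : 0 < a) (ha1 : a < 1)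
    (hy : y ∈ annulus n a) :
    InnerProductSpace.HarmonicOnNhd (fun x => imageSeries n a x y) (annulus n a) := by
  have ho : IsOpen (annulus n a) :=
    (isOpen_lt continuous_const continuous_norm).inter (isOpen_lt continuous_norm continuous_const)
  intro x hx
  refine ⟨(contDiffAt_imageSeries_left hn ha0 ha1 hx.1.le hx.2.le hy.1 hy.2).of_le two_le_infty, ?_⟩
  filter_upwards [ho.mem_nhds hx] with z hz
  exact laplacian_imageSeries_left hn ha0 ha1 hz.1.le hz.2.le hy.1 hy.2

lemma tendsto_imageWeight_mul (hn : 3 ≤ n) (ha0 : 0 < a) (ha1 : a < 1) {q : ℝ → ℝ} {s : ℝ}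
    (hq : Continuous q) (hq0 : q 0 ≠ 0) :
    Tendsto (fun j : ℕ => (a ^ (n - 2)) ^ j * q (a ^ (2 * j)) ^ s) atTop (𝓝 0) := by
  have h1 : Tendsto (fun j : ℕ => a ^ (2 * j)) atTop (𝓝 0) := by
    simp_rw [pow_mul]
    exact tendsto_pow_atTop_nhds_zero_of_lt_one (by positivity) (by nlinarith)
  have h2 : Tendsto (fun j : ℕ => (a ^ (n - 2)) ^ j) atTop (𝓝 0) :=
    tendsto_pow_atTop_nhds_zero_of_lt_one (by positivity)
      (pow_lt_one₀ ha0.le ha1 (by omega))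
  have h3 := ((hq.tendsto 0).comp h1).rpow_const (p := s) (Or.inl hq0)
  simpa using h2.mul h3

lemma tsum_eq_of_telescoping {f P : ℕ → ℝ} (hf : Summable f) (hP : Tendsto P atTop (𝓝 0))
    (h : ∀ j, f j = P j - P (j + 1)) : ∑' j, f j = P 0 := by
  have h1 := hf.hasSum.tendsto_sum_nat
  simp_rw [h, Finset.sum_range_sub'] at h1
  have h2 : Tendsto (fun N => P 0 - P N) atTop (𝓝 (P 0)) := by simpa using hP.const_sub (P 0)
  rw [tsum_congr h]
  exact tendsto_nhds_unique h1 h2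

lemma norm_sub_sq_eq (x y : EuclideanSpace ℝ (Fin n)) :
    ‖x - y‖ ^ 2 = ‖x‖ ^ 2 - 2 * inner ℝ x y + ‖y‖ ^ 2 := norm_sub_sq_real x y

lemma imageSeries_of_norm_eq_one (hn : 3 ≤ n) (ha0 : 0 < a) (ha1 : a < 1) (hx : ‖x‖ = 1)
    (hy : a < ‖y‖) (hy1 : ‖y‖ < 1) :
    imageSeries n a x y = (‖x - y‖ ^ 2) ^ (-(((n : ℝ) - 2) / 2)) := by
  have h := tsum_eq_of_telescoping
    (P := fun j => (a ^ (n - 2)) ^ j * outerQuad (a ^ (2 * j)) x y ^ (-(((n : ℝ) - 2) / 2)))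
    (summable_imageTerm hn ha0 ha1 (by rw [hx]; exact ha1.le) hx.le hy hy1)
    (tendsto_imageWeight_mul hn ha0 ha1 (q := fun l => outerQuad l x y)
      (by unfold outerQuad; fun_prop) (by simp [outerQuad])) ?_
  · rw [imageSeries, h, norm_sub_sq_eq, hx]
    simp only [pow_zero, one_mul, mul_zero, outerQuad, hx]
    congr 1
    ring
  · intro j
    -- On |x| = 1 one shifted image is the outer image of the next index, and the other cancels the
    -- inner image.
    have e1 : shiftQuad (a ^ 2 * a ^ (2 * j)) y x = outerQuad (a ^ (2 * (j + 1))) x y := by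
      rw [shiftQuad, outerQuad, real_inner_comm, hx]; ring
    have e2 : shiftQuad (a ^ 2 * a ^ (2 * j)) x y = innerQuad (a ^ 2 * a ^ (2 * j)) x y := by
      rw [shiftQuad, innerQuad, hx]; ring
    rw [imageTerm, e1, e2]
    ring

/-- The weight a^(n-2) absorbs a factor a² of the quadratic, as in the Kelvin transform in the
sphere of radius a. -/
lemma rpow_newton_exponent_mul (hn : 3 ≤ n) (ha0 : 0 < a) {q : ℝ} (hq : 0 ≤ q) :
    a ^ (n - 2) * (a ^ 2 * q) ^ (-(((n : ℝ) - 2) / 2)) = q ^ (-(((n : ℝ) - 2) / 2)) := by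
  rw [Real.mul_rpow (by positivity) hq, rpow_newton_exponent ha0.le hn]
  field_simp

lemma imageSeries_of_norm_eq_inner (hn : 3 ≤ n) (ha0 : 0 < a) (ha1 : a < 1) (hx : ‖x‖ = a)
    (hy : a < ‖y‖) (hy1 : ‖y‖ < 1) :
    imageSeries n a x y = (‖x - y‖ ^ 2) ^ (-(((n : ℝ) - 2) / 2)) := by
  have h := tsum_eq_of_telescoping
    (P := fun j => (a ^ (n - 2)) ^ j * shiftQuad (a ^ (2 * j)) x y ^ (-(((n : ℝ) - 2) / 2)))
    (summable_imageTerm hn ha0 ha1 hx.ge (by rw [hx]; exact ha1.le) hy hy1)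
    (tendsto_imageWeight_mul hn ha0 ha1 (q := fun l => shiftQuad l x y)
      (by unfold shiftQuad; fun_prop) (by
        have : 0 < ‖y‖ := ha0.trans hy
        simp only [shiftQuad]
        simp [this.ne'])) ?_
  · rw [imageSeries, h, norm_sub_sq_eq]
    simp only [pow_zero, one_mul, mul_zero, shiftQuad, one_pow]
  · intro j
    have hl := pow_two_mul_mem_Icc ha0 ha1 j
    obtain ⟨h1, h2, h3, h4⟩ := mem_imageDomain (n := n) (x := x) ha0 ha1 hl hx.ge
      (by rw [hx]; exact ha1.le) hy hy1
    simp only at h1 h2 h3 h4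
    -- On |x| = a the pairing changes: one shifted image cancels the outer image, and the inner
    -- image combines with the other shifted one to telescope.
    have e1 : shiftQuad (a ^ 2 * a ^ (2 * j)) y x = a ^ 2 * outerQuad (a ^ (2 * j)) x y := by
      rw [shiftQuad, outerQuad, real_inner_comm, hx]; ring
    have e2 : innerQuad (a ^ 2 * a ^ (2 * j)) x y = a ^ 2 * shiftQuad (a ^ (2 * j)) x y := by
      rw [shiftQuad, innerQuad, hx]; ring
    have e3 : a ^ 2 * a ^ (2 * j) = a ^ (2 * (j + 1)) := by ring
    have h5 : 0 ≤ shiftQuad (a ^ (2 * j)) x y := by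
      rw [e2] at h4
      exact (pos_of_mul_pos_right h4 (by positivity)).le
    rw [imageTerm, e1, mul_add (a ^ (n - 2)), rpow_newton_exponent_mul hn ha0 h1.le, e2,
      rpow_newton_exponent_mul hn ha0 h5, e3]
    ring

end ImageSeries

/-! ### Pairing with test functions, and uniqueness of the Green function. -/

section TestFunctions

variable {E : Type*} [NormedAddCommGroup E] [InnerProductSpace ℝ E] [FiniteDimensional ℝ E]
  [MeasurableSpace E] [BorelSpace E] {Ω : Set E} {φ : E → ℝ}

lemma integrableOn_mul_laplacian (hΩ : MeasurableSet Ω) {u : E → ℝ}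
    (hu : LocallyIntegrableOn u Ω) (hφ : ContDiff ℝ 2 φ) (hc : HasCompactSupport φ)
    (hs : tsupport φ ⊆ Ω) : IntegrableOn (fun x => u x * Δ φ x) Ω := by
  have h1 : IntegrableOn (fun x => u x * Δ φ x) (tsupport φ) :=
    (hu.integrableOn_compact_subset hs hc).mul_continuousOn (continuous_laplacian hφ).continuousOn
      hc
  refine h1.of_forall_sdiff_eq_zero hΩ fun x hx => ?_
  rw [image_eq_zero_of_notMem_tsupport fun h => hx.2 (tsupport_laplacian_subset h), mul_zero]

lemma setIntegral_mul_laplacian_eq (hs : tsupport φ ⊆ Ω) (u : E → ℝ) :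
    ∫ x in Ω, u x * Δ φ x = ∫ x, u x * Δ φ x := by
  refine setIntegral_eq_integral_of_forall_compl_eq_zero fun x hx => ?_
  rw [image_eq_zero_of_notMem_tsupport fun h => hx (hs (tsupport_laplacian_subset h)), mul_zero]

end TestFunctions

/-- Two Green functions of a bounded open set agree off the diagonal. -/
lemma IsGreenFunction.eq_of_ne {n : ℕ} (hn : 0 < n) {Ω : Set (EuclideanSpace ℝ (Fin n))}
    (hΩ : IsOpen Ω) (hb : Bornology.IsBounded Ω)
    {G G' : EuclideanSpace ℝ (Fin n) → EuclideanSpace ℝ (Fin n) → ℝ}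
    (hG : IsGreenFunction Ω G) (hG' : IsGreenFunction Ω G') {x y : EuclideanSpace ℝ (Fin n)}
    (hx : x ∈ Ω) (hy : y ∈ Ω) (hxy : x ≠ y) : G x y = G' x y := by
  have : Nonempty (Fin n) := ⟨⟨0, hn⟩⟩
  refine sub_eq_zero.1 (eq_zero_of_weakly_harmonic (u := fun x => G x y - G' x y) hΩ hb hy
    ((hG.locallyIntegrableOn y hy).sub (hG'.locallyIntegrableOn y hy))
    ((hG.continuousOn y hy).sub (hG'.continuousOn y hy)) ?_ ?_ hx hxy)
  · intro z hz
    rw [hG.eq_zero_on_boundary y hy z hz, hG'.eq_zero_on_boundary y hy z hz, sub_zero]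
  · intro φ hφ hc hs
    have h1 := hG.neg_laplacian_eq_dirac y hy φ hφ hc hs
    have h2 := hG'.neg_laplacian_eq_dirac y hy φ hφ hc hs
    simp_rw [mul_neg] at h1 h2
    rw [integral_neg] at h1 h2
    simp_rw [sub_mul]
    rw [integral_sub
      (integrableOn_mul_laplacian hΩ.measurableSet (hG.locallyIntegrableOn y hy)
        (hφ.of_le two_le_infty) hc hs)
      (integrableOn_mul_laplacian hΩ.measurableSet (hG'.locallyIntegrableOn y hy)
        (hφ.of_le two_le_infty) hc hs)]
    linarith

/-! ### The Green function and regular part of the annulus. -/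

section Annulus

variable {n : ℕ} {a : ℝ}

lemma isOpen_annulus : IsOpen (annulus n a) :=
  (isOpen_lt continuous_const continuous_norm).inter (isOpen_lt continuous_norm continuous_const)

lemma isBounded_annulus : Bornology.IsBounded (annulus n a) :=
  Metric.isBounded_closedBall.subset (s := annulus n a) (t := Metric.closedBall 0 1)
    fun x hx => by simpa using hx.2.le

lemma closure_annulus_subset {x : EuclideanSpace ℝ (Fin n)} (hx : x ∈ closure (annulus n a)) :
    a ≤ ‖x‖ ∧ ‖x‖ ≤ 1 := by
  have hc : IsClosed {x : EuclideanSpace ℝ (Fin n) | a ≤ ‖x‖ ∧ ‖x‖ ≤ 1} :=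
    (isClosed_le continuous_const continuous_norm).inter
      (isClosed_le continuous_norm continuous_const)
  exact closure_minimal (t := {x : EuclideanSpace ℝ (Fin n) | a ≤ ‖x‖ ∧ ‖x‖ ≤ 1})
    (fun x hx => ⟨hx.1.le, hx.2.le⟩) hc hx

lemma norm_of_mem_frontier_annulus {x : EuclideanSpace ℝ (Fin n)}
    (hx : x ∈ frontier (annulus n a)) : ‖x‖ = a ∨ ‖x‖ = 1 := by
  obtain ⟨h1, h2⟩ := closure_annulus_subset hx.1
  have h3 : x ∉ annulus n a := by
    have := hx.2
    rwa [isOpen_annulus.interior_eq] at this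
  by_contra! h
  exact h3 ⟨lt_of_le_of_ne h1 h.1.symm, lt_of_le_of_ne h2 h.2⟩

/-- The regular part of the Green function of the annulus, as a series of image charges. -/
noncomputable def annulusRegularPart (n : ℕ) (a : ℝ) (x y : EuclideanSpace ℝ (Fin n)) : ℝ :=
  -(1 / (((n : ℝ) - 2) * sphereArea n)) * imageSeries n a x y

/-- The Green function of the annulus. -/
noncomputable def annulusGreen (n : ℕ) (a : ℝ) (x y : EuclideanSpace ℝ (Fin n)) : ℝ :=
  newtonKernel n x y + annulusRegularPart n a x y

lemma isRegularPart_annulus (hn : 3 ≤ n) (ha0 : 0 < a) (ha1 : a < 1) :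
    IsRegularPart (annulus n a) (annulusGreen n a) (annulusRegularPart n a) where
  contDiffOn := by
    rintro ⟨x, y⟩ ⟨hx, hy⟩
    exact (contDiffAt_const.mul (contDiffAt_imageSeries hn ha0 ha1 hx.1.le hx.2.le hy.1
      hy.2)).contDiffWithinAt
  harmonic_left y hy := (harmonicOnNhd_imageSeries_left hn ha0 ha1 hy).const_smul
  harmonic_right x hx := by
    have h := (harmonicOnNhd_imageSeries_left hn ha0 ha1 hx).const_smul
      (c := -(1 / (((n : ℝ) - 2) * sphereArea n)))
    have e : (fun y => annulusRegularPart n a x y) =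
        -(1 / (((n : ℝ) - 2) * sphereArea n)) • fun y => imageSeries n a y x := by
      ext y
      simp [annulusRegularPart, imageSeries_comm (x := x)]
    rwa [e]
  eq_add _ _ _ _ _ := rfl

lemma locallyIntegrable_newtonKernel (hn : 3 ≤ n) (y : EuclideanSpace ℝ (Fin n)) :
    LocallyIntegrable fun x => newtonKernel n x y := by
  simp_rw [newtonKernel_eq hn]
  have h := locallyIntegrable_rpow_norm hn
  rw [← map_sub_right_eq_self volume y] at h
  have h2 := (locallyIntegrable_map_homeomorph (Homeomorph.subRight y)).1 h
  exact LocallyIntegrable.smul h2 (1 / (((n : ℝ) - 2) * sphereArea n))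

lemma continuousAt_newtonKernel (hn : 3 ≤ n) {x y : EuclideanSpace ℝ (Fin n)} (hxy : x ≠ y) :
    ContinuousAt (fun x => newtonKernel n x y) x := by
  have hn' : (3 : ℝ) ≤ n := by exact_mod_cast hn
  have h2 : (0 : ℝ) < n - 2 := by linarith
  have hω := sphereArea_pos (n := n) (by omega)
  have : 0 < ‖x - y‖ := norm_pos_iff.2 (sub_ne_zero.2 hxy)
  unfold newtonKernel
  exact ContinuousAt.div continuousAt_const (by fun_prop) (by positivity)

lemma contDiffAt_annulusRegularPart_left (hn : 3 ≤ n) (ha0 : 0 < a) (ha1 : a < 1)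
    {x y : EuclideanSpace ℝ (Fin n)} (hx : x ∈ closure (annulus n a)) (hy : y ∈ annulus n a) :
    ContDiffAt ℝ ∞ (fun x => annulusRegularPart n a x y) x := by
  obtain ⟨h1, h2⟩ := closure_annulus_subset hx
  exact contDiffAt_const.mul (contDiffAt_imageSeries_left hn ha0 ha1 h1 h2 hy.1 hy.2)

lemma isGreenFunction_annulus (hn : 3 ≤ n) (ha0 : 0 < a) (ha1 : a < 1) :
    IsGreenFunction (annulus n a) (annulusGreen n a) := by
  have hreg (y : EuclideanSpace ℝ (Fin n)) (hy : y ∈ annulus n a) :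
      LocallyIntegrableOn (fun x => annulusRegularPart n a x y) (annulus n a) :=
    ContinuousOn.locallyIntegrableOn (fun x hx =>
      (contDiffAt_annulusRegularPart_left hn ha0 ha1 (subset_closure hx)
        hy).continuousAt.continuousWithinAt) isOpen_annulus.measurableSet
  have hnewt (y : EuclideanSpace ℝ (Fin n)) :
      LocallyIntegrableOn (fun x => newtonKernel n x y) (annulus n a) :=
    (locallyIntegrable_newtonKernel hn y).locallyIntegrableOn _
  refine ⟨fun y hy => (hnewt y).add (hreg y hy), fun y hy φ hφ hc hs => ?_,
    fun y hy x hx => ?_, fun y hy x hx => ?_⟩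
  · have hφ2 := hφ.of_le two_le_infty
    have h1 := integral_newtonKernel_mul_laplacian hn hφ2 hc y
    have h2 := integral_mul_laplacian_eq (f := fun x => annulusRegularPart n a x y) hφ2 hc
      fun x hx => (contDiffAt_annulusRegularPart_left hn ha0 ha1 (subset_closure (hs hx))
        hy).of_le two_le_infty
    have h3 : ∫ x, Δ (fun x => annulusRegularPart n a x y :
        EuclideanSpace ℝ (Fin n) → ℝ) x * φ x = 0 := by
      rw [← integral_zero (EuclideanSpace ℝ (Fin n)) ℝ]
      congr 1
      ext x
      by_cases hx : x ∈ tsupport φ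
      · have := ((isRegularPart_annulus hn ha0 ha1).harmonic_left y hy x (hs hx)).2.eq_of_nhds
        rw [this, Pi.zero_apply, zero_mul]
      · rw [image_eq_zero_of_notMem_tsupport hx, mul_zero]
    simp_rw [mul_neg] at h1 ⊢
    rw [integral_neg] at h1 ⊢
    simp_rw [annulusGreen, add_mul]
    rw [integral_add (integrableOn_mul_laplacian isOpen_annulus.measurableSet (hnewt y) hφ2 hc hs)
      (integrableOn_mul_laplacian isOpen_annulus.measurableSet (hreg y hy) hφ2 hc hs),
      setIntegral_mul_laplacian_eq hs, setIntegral_mul_laplacian_eq hs, h2, h3, add_zero, h1]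
  · exact ((continuousAt_newtonKernel hn hx.2).add (contDiffAt_annulusRegularPart_left hn ha0 ha1
      hx.1 hy).continuousAt).continuousWithinAt
  · have h : imageSeries n a x y = (‖x - y‖ ^ 2) ^ (-(((n : ℝ) - 2) / 2)) := by
      rcases norm_of_mem_frontier_annulus hx with h | h
      · exact imageSeries_of_norm_eq_inner hn ha0 ha1 h hy.1 hy.2
      · exact imageSeries_of_norm_eq_one hn ha0 ha1 h hy.1 hy.2
    rw [annulusGreen, annulusRegularPart, newtonKernel_eq hn, h]
    ring

/-- Any regular part of a Green function of the annulus is the series of image charges. -/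
lemma IsRegularPart.eq_annulusRegularPart (hn : 3 ≤ n) (ha0 : 0 < a) (ha1 : a < 1)
    {G H : EuclideanSpace ℝ (Fin n) → EuclideanSpace ℝ (Fin n) → ℝ}
    (hG : IsGreenFunction (annulus n a) G) (hH : IsRegularPart (annulus n a) G H)
    {x : EuclideanSpace ℝ (Fin n)} (hx : x ∈ annulus n a) :
    H x x = annulusRegularPart n a x x := by
  have : Nonempty (Fin n) := ⟨⟨0, by omega⟩⟩
  have hcont {K : EuclideanSpace ℝ (Fin n) → EuclideanSpace ℝ (Fin n) → ℝ}
      (hK : ContDiffOn ℝ ∞ (Function.uncurry K) (annulus n a ×ˢ annulus n a)) :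
      Tendsto (fun z => K z x) (𝓝[≠] x) (𝓝 (K x x)) := by
    have h1 : ContinuousAt (Function.uncurry K) (x, x) :=
      hK.continuousOn.continuousAt ((isOpen_annulus.prod isOpen_annulus).mem_nhds ⟨hx, hx⟩)
    have h2 : ContinuousAt (fun z => K z x) x :=
      h1.comp (f := fun z => (z, x)) (by fun_prop)
    exact h2.tendsto.mono_left nhdsWithin_le_nhds
  -- Uniqueness of G says nothing at the pole, so the diagonal value is recovered as a limit through
  -- z ≠ x, where the regular parts agree.
  refine tendsto_nhds_unique (hcont hH.contDiffOn)
    ((hcont (isRegularPart_annulus hn ha0 ha1).contDiffOn).congr' ?_)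
  filter_upwards [self_mem_nhdsWithin, nhdsWithin_le_nhds (isOpen_annulus.mem_nhds hx)] with z hz hzΩ
  have h1 := hH.eq_add z hzΩ x hx hz
  have h2 := (isRegularPart_annulus hn ha0 ha1).eq_add z hzΩ x hx hz
  have h3 := hG.eq_of_ne (by omega) isOpen_annulus isBounded_annulus
    (isGreenFunction_annulus hn ha0 ha1) hzΩ hx hz
  linarith

end Annulus

/-! ### The generating function of the Gegenbauer polynomials. -/

section Gegenbauer

/-- The coefficients of the power series of `(1 - z)^(-s)`. -/
noncomputable def risingCoeff (s : ℝ) (p : ℕ) : ℝ :=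
  (∏ j ∈ Finset.range p, (s + j)) / p.factorial

/-- The Gegenbauer polynomial `C_m^s(c)`, that is, the coefficients of the power series of
`(1 - 2 c t + t²)^(-s)`. -/
noncomputable def gegenbauer (s c : ℝ) (m : ℕ) : ℝ :=
  ∑ q ∈ Finset.HasAntidiagonal.antidiagonal m,
    risingCoeff s q.1 * (q.1.choose q.2 * (2 * c) ^ (q.1 - q.2) * (-1) ^ q.2)

lemma ascPochhammer_smeval_eq_prod (s : ℝ) (p : ℕ) :
    (ascPochhammer ℕ p).smeval s = ∏ j ∈ Finset.range p, (s + j) := by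
  induction p with
  | zero => simp
  | succ p ih =>
    rw [ascPochhammer_succ_right, Finset.prod_range_succ, ← ih, Polynomial.smeval_mul]
    simp [Polynomial.smeval_add, Polynomial.smeval_natCast]

lemma choose_eq_risingCoeff (s : ℝ) (p : ℕ) : Ring.choose (s + p - 1) p = risingCoeff s p := by
  have h := Ring.factorial_nsmul_multichoose_eq_ascPochhammer s p
  rw [ascPochhammer_smeval_eq_prod, Ring.multichoose_eq, nsmul_eq_mul] at h
  rw [risingCoeff, eq_div_iff (by positivity), ← h, mul_comm]

lemma hasSum_risingCoeff (s : ℝ) {z : ℂ} (hz : ‖z‖ < 1) :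
    HasSum (fun p => (risingCoeff s p : ℂ) * z ^ p) (1 / (1 - z) ^ (s : ℂ)) := by
  have h := (Complex.one_div_one_sub_cpow_hasFPowerSeriesOnBall_zero (s : ℂ)).hasSum (y := z)
    (by simpa [← ofReal_norm] using hz)
  rw [zero_add] at h
  refine h.congr_fun fun p => ?_
  have : Ring.choose ((s : ℂ) + p - 1) p = (risingCoeff s p : ℂ) := by
    rw [← choose_eq_risingCoeff, Complex.ofReal_choose]
    push_cast
    rfl
  simp [this, mul_comm]

lemma hasSum_binomial_expansion {R : Type*} [NormedCommRing R] (B x y : R) (p : ℕ) :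
    HasSum (fun k => B * (p.choose k * y ^ (p - k) * x ^ k)) (B * (x + y) ^ p) := by
  refine HasSum.mul_left B ?_
  rw [add_pow]
  have : ∑ k ∈ Finset.range (p + 1), x ^ k * y ^ (p - k) * (p.choose k : R) =
      ∑ k ∈ Finset.range (p + 1), (p.choose k * y ^ (p - k) * x ^ k) :=
    Finset.sum_congr rfl fun k _ => by ring
  rw [this]
  refine hasSum_sum_of_ne_finset_zero fun k hk => ?_
  rw [Nat.choose_eq_zero_of_lt (by simpa using hk)]
  simp

lemma hasSum_gegenbauer_of_norm_lt_quarter {s c : ℝ} (hc : |c| ≤ 1) {t : ℂ} (ht : ‖t‖ < 1 / 4) :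
    HasSum (fun m => (gegenbauer s c m : ℂ) * t ^ m)
      (1 / (1 - (-t ^ 2 + 2 * c * t)) ^ (s : ℂ)) := by
  set f : ℕ × ℕ → ℂ := fun q =>
    (risingCoeff s q.1 : ℂ) * (q.1.choose q.2 * (2 * c * t) ^ (q.1 - q.2) * (-t ^ 2) ^ q.2) with hf
  set r : ℝ := ‖-t ^ 2‖ + ‖2 * c * t‖ with hr
  -- For |t| < 1/4 and |c| ≤ 1, |t|² + 2|c||t| < 1/16 + 1/2, so the double expansion converges
  -- absolutely.
  have hr1 : r < 1 := by
    have h1 : ‖-t ^ 2‖ = ‖t‖ ^ 2 := by simp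
    have h2 : ‖2 * c * t‖ = 2 * |c| * ‖t‖ := by simp
    rw [hr, h1, h2]
    nlinarith [norm_nonneg t, abs_nonneg c]
  have hr0 : 0 ≤ r := by positivity
  have hz : ‖-t ^ 2 + 2 * c * t‖ < 1 := (norm_add_le _ _).trans_lt hr1
  have hinner (p : ℕ) : HasSum (fun k => f (p, k))
      ((risingCoeff s p : ℂ) * (-t ^ 2 + 2 * c * t) ^ p) :=
    hasSum_binomial_expansion _ _ _ p
  have hinner' (p : ℕ) : HasSum (fun k => ‖f (p, k)‖) (|risingCoeff s p| * r ^ p) := by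
    have := hasSum_binomial_expansion |risingCoeff s p| ‖-t ^ 2‖ ‖2 * c * t‖ p
    refine this.congr_fun fun k => ?_
    simp [hf]
  have hbs : Summable fun p => |risingCoeff s p| * r ^ p := by
    have h := (hasSum_risingCoeff s (z := (r : ℂ)) (by simpa [abs_of_nonneg hr0] using hr1))
    refine h.summable.norm.congr fun p => ?_
    simp [abs_of_nonneg hr0]
  have hsum : Summable f := by
    refine Summable.of_norm ?_
    rw [summable_prod_of_nonneg fun _ => norm_nonneg _]
    refine ⟨fun p => (hinner' p).summable, ?_⟩
    simp_rw [fun p => (hinner' p).tsum_eq]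
    exact hbs
  have hval : HasSum f (1 / (1 - (-t ^ 2 + 2 * c * t)) ^ (s : ℂ)) := by
    have h1 := hsum.hasSum.prod_fiberwise hinner
    rw [← h1.unique (hasSum_risingCoeff s hz)]
    exact hsum.hasSum
  -- Since t^(p-k) (t²)^k = t^(p+k), collecting powers of t means summing along antidiagonals.
  rw [← Finset.HasAntidiagonal.sigmaAntidiagonalEquivProd.hasSum_iff] at hval
  refine hval.sigma fun m => ?_
  have h := hasSum_fintype
    (fun q : Finset.HasAntidiagonal.antidiagonal m => f q)
  have e : ∑ q : Finset.HasAntidiagonal.antidiagonal m, f q = (gegenbauer s c m : ℂ) * t ^ m := by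
    rw [Finset.sum_coe_sort (Finset.HasAntidiagonal.antidiagonal m) f, gegenbauer,
      Complex.ofReal_sum, Finset.sum_mul]
    refine Finset.sum_congr rfl fun q hq => ?_
    have hq : q.1 + q.2 = m := Finset.HasAntidiagonal.mem_antidiagonal.1 hq
    rcases le_or_gt q.2 q.1 with hle | hlt
    · have hp : t ^ m = t ^ (q.1 - q.2) * (t ^ 2) ^ q.2 := by
        rw [← pow_mul, ← pow_add]
        congr 1
        omega
      rw [hp, hf]
      push_cast
      rw [mul_pow (2 * (c : ℂ)) t, neg_pow (t ^ 2)]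
      ring
    · simp [hf, Nat.choose_eq_zero_of_lt hlt]
  rwa [e] at h

lemma one_sub_two_mul_add_sq_pos {c t : ℝ} (hc : |c| ≤ 1) (ht : |t| < 1) :
    0 < 1 - 2 * c * t + t ^ 2 := by
  obtain ⟨h1, h2⟩ := abs_le.1 hc
  obtain ⟨h3, h4⟩ := abs_lt.1 ht
  have : c * t ≤ |t| := by
    calc c * t ≤ |c * t| := le_abs_self _
      _ = |c| * |t| := abs_mul _ _
      _ ≤ 1 * |t| := by gcongr
      _ = |t| := one_mul _
  nlinarith [sq_abs t, abs_nonneg t]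

/-- The imaginary part vanishes only for real t or for Re t = c; in both cases the real part is
positive. -/
lemma one_sub_mem_slitPlane {c : ℝ} (hc : |c| ≤ 1) {t : ℂ} (ht : ‖t‖ < 1) :
    1 - (-t ^ 2 + 2 * c * t) ∈ Complex.slitPlane := by
  have hn : t.re ^ 2 + t.im ^ 2 < 1 := by
    have : ‖t‖ ^ 2 < 1 := by nlinarith [norm_nonneg t]
    rw [Complex.sq_norm, Complex.normSq_apply] at this
    linarith
  have hre : (1 - (-t ^ 2 + 2 * c * t)).re = 1 + t.re ^ 2 - t.im ^ 2 - 2 * c * t.re := by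
    simp [pow_two]; ring
  have him : (1 - (-t ^ 2 + 2 * c * t)).im = 2 * t.im * (t.re - c) := by
    simp [pow_two]; ring
  rw [Complex.mem_slitPlane_iff, hre, him]
  by_cases h : 2 * t.im * (t.re - c) = 0
  · left
    rcases mul_eq_zero.1 h with h | h
    · have h0 : t.im = 0 := by linarith
      rw [h0] at hn ⊢
      have : |t.re| < 1 := by rw [← sq_lt_one_iff_abs_lt_one]; linarith
      have := one_sub_two_mul_add_sq_pos hc this
      linarith
    · have h0 : t.re = c := by linarith
      rw [h0] at hn ⊢
      nlinarith
  · exact Or.inr h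

/-- The generating function of the Gegenbauer polynomials, in the complex unit disc. -/
lemma hasSum_gegenbauer_complex {s c : ℝ} (hc : |c| ≤ 1) {t : ℂ} (ht : ‖t‖ < 1) :
    HasSum (fun m => (gegenbauer s c m : ℂ) * t ^ m)
      (1 / (1 - (-t ^ 2 + 2 * c * t)) ^ (s : ℂ)) := by
  set F : ℂ → ℂ := fun t => 1 / (1 - (-t ^ 2 + 2 * c * t)) ^ (s : ℂ) with hF
  obtain ⟨R, htR, hR1⟩ := exists_between ht
  have hR0 : 0 < R := (norm_nonneg t).trans_lt htR
  lift R to NNReal using hR0.le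
  have hd : DifferentiableOn ℂ F (Metric.closedBall 0 R) := by
    intro z hz
    have hz : ‖z‖ < 1 := by
      have : ‖z‖ ≤ R := by simpa using hz
      linarith
    have hsp := one_sub_mem_slitPlane hc hz
    refine DifferentiableAt.differentiableWithinAt ?_
    refine DifferentiableAt.div (differentiableAt_const _)
      (DifferentiableAt.cpow_const (by fun_prop) hsp) ?_
    rw [Complex.cpow_def_of_ne_zero (Complex.slitPlane_ne_zero hsp)]
    exact Complex.exp_ne_zero _
  -- Holomorphy gives a Taylor series on the disc of radius R; the expansion already known on the
  -- quarter disc identifies its coefficients.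
  have h1 := hd.hasFPowerSeriesOnBall (by exact_mod_cast hR0)
  have h2 : HasFPowerSeriesAt F
      (FormalMultilinearSeries.ofScalars ℂ fun m => (gegenbauer s c m : ℂ)) 0 := by
    rw [hasFPowerSeriesAt_iff]
    filter_upwards [Metric.ball_mem_nhds (0 : ℂ) (by norm_num : (0 : ℝ) < 1 / 4)] with z hz
    have := hasSum_gegenbauer_of_norm_lt_quarter (s := s) hc (t := z) (by simpa using hz)
    rw [zero_add]
    refine this.congr_fun fun m => ?_
    simp [FormalMultilinearSeries.coeff_ofScalars, mul_comm]
  rw [h1.hasFPowerSeriesAt.eq_formalMultilinearSeries h2] at h1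
  have h3 := h1.hasSum (y := t) (by simpa [← ofReal_norm, ENNReal.ofReal_lt_coe_iff] using htR)
  rw [zero_add] at h3
  refine h3.congr_fun fun m => ?_
  simp [mul_comm]

/-- The generating function of the Gegenbauer polynomials. -/
lemma hasSum_gegenbauer {s c t : ℝ} (hc : |c| ≤ 1) (ht : |t| < 1) :
    HasSum (fun m => gegenbauer s c m * t ^ m) ((1 - 2 * c * t + t ^ 2) ^ (-s)) := by
  have hpos := one_sub_two_mul_add_sq_pos hc ht
  have h := hasSum_gegenbauer_complex (s := s) hc (t := (t : ℂ)) (by simpa using ht)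
  rw [← Complex.hasSum_ofReal]
  have e : ((((1 - 2 * c * t + t ^ 2) ^ (-s) : ℝ)) : ℂ) =
      1 / (1 - (-(t : ℂ) ^ 2 + 2 * c * t)) ^ (s : ℂ) := by
    rw [Real.rpow_neg hpos.le, Complex.ofReal_inv, Complex.ofReal_cpow hpos.le, one_div]
    push_cast
    congr 2
    ring
  rw [e]
  exact_mod_cast h

/-- `C_m^s(1)` in the case `2 s = N + 1`. -/
lemma gegenbauer_one (N m : ℕ) :
    gegenbauer (((N : ℝ) + 1) / 2) 1 m = ((N + m).choose N : ℝ) := by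
  have h1 := (Real.one_div_sub_pow_hasFPowerSeriesOnBall_zero N
    (one_ne_zero (α := ℝ))).hasFPowerSeriesAt
  have h2 : HasFPowerSeriesAt (fun x : ℝ => 1 / (1 - x) ^ (N + 1))
      (FormalMultilinearSeries.ofScalars ℝ fun m => gegenbauer (((N : ℝ) + 1) / 2) 1 m) 0 := by
    rw [hasFPowerSeriesAt_iff]
    filter_upwards [Metric.ball_mem_nhds (0 : ℝ) one_pos] with z hz
    have hz : |z| < 1 := by simpa using hz
    have h := hasSum_gegenbauer (s := ((N : ℝ) + 1) / 2) (c := 1) (by simp) hz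
    have hz1 : 0 < 1 - z := by linarith [(abs_lt.1 hz).2]
    -- At c = 1 the quadratic is a perfect square, and the series reduces to that of (1-z)^(-(N+1)).
    have e : (1 - 2 * 1 * z + z ^ 2) ^ (-(((N : ℝ) + 1) / 2)) = 1 / (1 - z) ^ (N + 1) := by
      rw [show 1 - 2 * 1 * z + z ^ 2 = (1 - z) ^ 2 by ring, Real.rpow_neg (by positivity),
        ← Real.rpow_natCast (1 - z) 2, ← Real.rpow_mul hz1.le, one_div,
        ← Real.rpow_natCast (1 - z) (N + 1)]
      congr 2
      push_cast
      ring
    rw [e] at h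
    rw [zero_add]
    refine h.congr_fun fun m => ?_
    simp [FormalMultilinearSeries.coeff_ofScalars, mul_comm]
  have h3 := congrArg (fun p => p.coeff m) (h2.eq_formalMultilinearSeries h1)
  simpa [FormalMultilinearSeries.coeff_ofScalars] using h3

end Gegenbauer

/-! ### Zonal harmonics as Gegenbauer polynomials. -/

section Zonal

lemma gegenbauer_eq_sum_range (s c : ℝ) (m : ℕ) :
    gegenbauer s c m = ∑ k ∈ Finset.range (m / 2 + 1),
      risingCoeff s (m - k) * ((m - k).choose k * (2 * c) ^ (m - 2 * k) * (-1) ^ k) := by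
  rw [gegenbauer, ← Finset.Nat.sum_antidiagonal_swap]
  simp only [Prod.fst_swap, Prod.snd_swap]
  rw [Finset.Nat.sum_antidiagonal_eq_sum_range_succ
    (fun k p => risingCoeff s p * (p.choose k * (2 * c) ^ (p - k) * (-1) ^ k))]
  symm
  refine (Finset.sum_congr rfl fun k _ => ?_).trans
    (Finset.sum_subset (Finset.range_subset_range.2 (by omega)) fun k _ hk => ?_)
  · rw [show m - 2 * k = m - k - k by omega]
  · rw [Nat.choose_eq_zero_of_lt (by simp at hk; omega)]
    simp

/-- Converts the rising factorial of (n-2)/2 into the product n(n+2)⋯ in the zonal harmonic; the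
first factor supplies n-2. -/
lemma prod_half_add (a : ℝ) (p : ℕ) : ∏ j ∈ Finset.range (p + 1), ((a - 2) / 2 + j) =
    (a - 2) * (∏ j ∈ Finset.range p, (a + 2 * j)) / 2 ^ (p + 1) := by
  induction p with
  | zero => simp
  | succ p ih =>
    rw [Finset.prod_range_succ, ih, Finset.prod_range_succ _ p]
    push_cast
    field_simp
    ring

/-- The zonal harmonics are multiples of the Gegenbauer polynomials. -/
lemma zonalHarmonic_eq {n : ℕ} (hn : 3 ≤ n) (m : ℕ) {x ξ : EuclideanSpace ℝ (Fin n)}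
    (hx : ‖x‖ = 1) : zonalHarmonic n m x ξ =
      (2 * (m : ℝ) + n - 2) / (n - 2) * gegenbauer (((n : ℝ) - 2) / 2) (inner ℝ x ξ) m := by
  have hn' : (3 : ℝ) ≤ n := by exact_mod_cast hn
  have h2 : (n : ℝ) - 2 ≠ 0 := by linarith
  rw [gegenbauer_eq_sum_range, zonalHarmonic]
  split_ifs with hm
  · subst hm
    simp [risingCoeff, h2]
  · rw [div_mul_eq_mul_div, mul_div_assoc, Finset.sum_div,
      show (n : ℝ) + 2 * m - 2 = 2 * m + n - 2 by ring]
    congr 1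
    refine Finset.sum_congr rfl fun k hk => ?_
    have hk : 2 * k ≤ m := by simp at hk; omega
    obtain ⟨p, hp⟩ : ∃ p, m - k = p + 1 := ⟨m - k - 1, by omega⟩
    have hmk : m - 2 * k = p + 1 - k := by omega
    have hkp : k ≤ p + 1 := by omega
    have hpow : (2 : ℝ) ^ (p + 1) = 2 ^ (p + 1 - k) * 2 ^ k := by
      rw [← pow_add]; congr 1; omega
    rw [hp, hmk, hx, risingCoeff, prod_half_add, Nat.cast_choose ℝ hkp, mul_pow, hpow,
      Nat.add_sub_cancel]
    simp only [one_pow, mul_one]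
    field_simp

/-- The value of the zonal harmonics on the diagonal. -/
lemma zonalHarmonic_self {n : ℕ} (hn : 3 ≤ n) (m : ℕ) {x : EuclideanSpace ℝ (Fin n)}
    (hx : ‖x‖ = 1) : zonalHarmonic n m x x = harmonicWeight n m := by
  obtain ⟨N, rfl⟩ : ∃ N, n = N + 3 := ⟨n - 3, by omega⟩
  rw [zonalHarmonic_eq hn m hx, real_inner_self_eq_norm_sq, hx, one_pow]
  have e : (((N + 3 : ℕ) : ℝ) - 2) / 2 = ((N : ℝ) + 1) / 2 := by push_cast; ring
  rw [e, gegenbauer_one, harmonicWeight]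
  have hN : ((N + 3 : ℕ) : ℝ) - 2 = N + 1 := by push_cast; ring
  have hN0 : (N : ℝ) + 1 ≠ 0 := by positivity
  rw [show 2 * (m : ℝ) + ((N + 3 : ℕ) : ℝ) - 2 = 2 * m + N + 1 by push_cast; ring, hN]
  split_ifs with hm
  · subst hm
    simp [hN0]
  -- Split 2m+N+1 as (N+m+1) + m; each part, multiplied by C(N+m,N)/(N+1), is one of the two
  -- binomials of the weight.
  · have h1 : (N + 3 + m - 2).choose (N + 3 - 2) * (N + 1) = (N + m).choose N * (N + m + 1) := by
      rw [show N + 3 + m - 2 = N + m + 1 by omega, show N + 3 - 2 = N + 1 by omega]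
      rw [← Nat.add_one_mul_choose_eq]
      ring
    have h2 : (N + 3 + m - 3).choose (N + 3 - 2) * (N + 1) = (N + m).choose N * m := by
      rw [show N + 3 + m - 3 = N + m by omega, show N + 3 - 2 = N + 1 by omega,
        Nat.choose_succ_right_eq]
      simp
    have h1' : ((N + 3 + m - 2).choose (N + 3 - 2) : ℝ) * (N + 1) =
        (N + m).choose N * (N + m + 1) := by exact_mod_cast h1
    have h2' : ((N + 3 + m - 3).choose (N + 3 - 2) : ℝ) * (N + 1) = (N + m).choose N * m := by
      exact_mod_cast h2
    rw [div_mul_eq_mul_div, div_eq_iff hN0, Nat.cast_add]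
    linear_combination -h1' - h2'

end Zonal

/-! ### Expansion of the image series in zonal harmonics. -/

section Series

variable {n : ℕ} {a : ℝ} {x y : EuclideanSpace ℝ (Fin n)}

/-- The generating function at t = q/p, homogenized so that it fits all four image potentials. -/
lemma hasSum_kelvin (hn : 3 ≤ n) {p q c : ℝ} (hp : 0 < p) (hq : 0 ≤ q) (hqp : q < p)
    (hc : |c| ≤ 1) :
    HasSum (fun m => gegenbauer (((n : ℝ) - 2) / 2) c m * ((p ^ (n - 2))⁻¹ * (q / p) ^ m))
      ((p ^ 2 - 2 * c * p * q + q ^ 2) ^ (-(((n : ℝ) - 2) / 2))) := by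
  have ht : |q / p| < 1 := by
    rw [abs_of_nonneg (by positivity)]
    exact (div_lt_one hp).2 hqp
  have h := (hasSum_gegenbauer (s := ((n : ℝ) - 2) / 2) hc ht).mul_left (p ^ (n - 2))⁻¹
  have e : p ^ 2 - 2 * c * p * q + q ^ 2 = p ^ 2 * (1 - 2 * c * (q / p) + (q / p) ^ 2) := by
    field_simp
  rw [e, Real.mul_rpow (by positivity) (one_sub_two_mul_add_sq_pos hc ht).le,
    rpow_newton_exponent hp.le hn]
  refine h.congr_fun fun m => ?_
  ring

/-- The radial factor of the `m`-th term of the expansion of the regular part. -/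
noncomputable def radialFactor (n : ℕ) (a r s : ℝ) (m : ℕ) : ℝ :=
  (r * s) ^ m - a ^ (n - 2) * ((s ^ (n - 2))⁻¹ * (a ^ 2 * r / s) ^ m +
    (r ^ (n - 2))⁻¹ * (a ^ 2 * s / r) ^ m) +
    a ^ (n - 2) * (((r * s) ^ (n - 2))⁻¹ * (a ^ 2 / (r * s)) ^ m)

lemma abs_inner_div_le_one (x y : EuclideanSpace ℝ (Fin n)) :
    |inner ℝ x y / (‖x‖ * ‖y‖)| ≤ 1 := abs_real_inner_div_norm_mul_norm_le_one x y

lemma hasSum_imageTerm (hn : 3 ≤ n) (ha0 : 0 < a) (ha1 : a < 1) (hx : x ∈ annulus n a)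
    (hy : y ∈ annulus n a) {l : ℝ} (hl : l ∈ Icc (0 : ℝ) 1) :
    HasSum (fun m => l ^ m * (gegenbauer (((n : ℝ) - 2) / 2) (inner ℝ x y / (‖x‖ * ‖y‖)) m *
      radialFactor n a ‖x‖ ‖y‖ m)) (imageTerm n a l x y) := by
  obtain ⟨hl0, hl1⟩ := hl
  obtain ⟨hx0, hx1⟩ := hx
  obtain ⟨hy0, hy1⟩ := hy
  have hr : 0 < ‖x‖ := ha0.trans hx0
  have hs : 0 < ‖y‖ := ha0.trans hy0
  set r := ‖x‖ with hrdef
  set s := ‖y‖ with hsdef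
  set c := inner ℝ x y / (r * s) with hcdef
  have hc : |c| ≤ 1 := abs_inner_div_le_one x y
  have hin : inner ℝ x y = c * (r * s) := by rw [hcdef]; field_simp
  have ha2 : a ^ 2 < a := by nlinarith
  have hm0 : 0 ≤ a ^ 2 * l := by positivity
  have hm1 : a ^ 2 * l ≤ a ^ 2 := mul_le_of_le_one_right (by positivity) hl1
  have h1 := hasSum_kelvin hn (p := 1) (q := l * (r * s)) one_pos (by positivity) (by
    have : r * s < 1 := mul_lt_one_of_nonneg_of_lt_one_left hr.le hx1 hy1.le
    have : l * (r * s) ≤ r * s := mul_le_of_le_one_left (by positivity) hl1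
    linarith) hc
  have h2 := hasSum_kelvin hn (p := s) (q := a ^ 2 * l * r) hs (by positivity) (by
    have : a ^ 2 * l * r ≤ a ^ 2 * l := mul_le_of_le_one_right hm0 hx1.le
    linarith) hc
  have h3 := hasSum_kelvin hn (p := r) (q := a ^ 2 * l * s) hr (by positivity) (by
    have : a ^ 2 * l * s ≤ a ^ 2 * l := mul_le_of_le_one_right hm0 hy1.le
    linarith) hc
  have h4 := hasSum_kelvin hn (p := r * s) (q := a ^ 2 * l) (by positivity) hm0 (by
    have : a * a < r * s := mul_lt_mul'' hx0 hy0 ha0.le ha0.le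
    nlinarith) hc
  have e1 : outerQuad l x y = 1 ^ 2 - 2 * c * 1 * (l * (r * s)) + (l * (r * s)) ^ 2 := by
    rw [outerQuad, hin]; ring
  have e2 : shiftQuad (a ^ 2 * l) x y =
      s ^ 2 - 2 * c * s * (a ^ 2 * l * r) + (a ^ 2 * l * r) ^ 2 := by
    rw [shiftQuad, hin]; ring
  have e3 : shiftQuad (a ^ 2 * l) y x =
      r ^ 2 - 2 * c * r * (a ^ 2 * l * s) + (a ^ 2 * l * s) ^ 2 := by
    rw [shiftQuad, real_inner_comm, hin]; ring
  have e4 : innerQuad (a ^ 2 * l) x y =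
      (r * s) ^ 2 - 2 * c * (r * s) * (a ^ 2 * l) + (a ^ 2 * l) ^ 2 := by
    rw [innerQuad, hin]; ring
  rw [imageTerm, e1, e2, e3, e4]
  refine ((h1.sub ((h2.add h3).mul_left (a ^ (n - 2)))).add
    (h4.mul_left (a ^ (n - 2)))).congr_fun fun m => ?_
  simp only [radialFactor, one_pow, inv_one, one_mul, div_one]
  rw [show a ^ 2 * l * r / s = l * (a ^ 2 * r / s) by ring,
    show a ^ 2 * l * s / r = l * (a ^ 2 * s / r) by ring,
    show a ^ 2 * l / (r * s) = l * (a ^ 2 / (r * s)) by ring,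
    mul_pow l (r * s), mul_pow l (a ^ 2 * r / s), mul_pow l (a ^ 2 * s / r),
    mul_pow l (a ^ 2 / (r * s))]
  ring

lemma hasSum_imageSeries (hn : 3 ≤ n) (ha0 : 0 < a) (ha1 : a < 1) (hx : x ∈ annulus n a)
    (hy : y ∈ annulus n a) :
    HasSum (fun m => gegenbauer (((n : ℝ) - 2) / 2) (inner ℝ x y / (‖x‖ * ‖y‖)) m *
      radialFactor n a ‖x‖ ‖y‖ m / (1 - a ^ (2 * m + n - 2))) (imageSeries n a x y) := by
  set g : ℕ → ℝ := fun m => gegenbauer (((n : ℝ) - 2) / 2) (inner ℝ x y / (‖x‖ * ‖y‖)) m *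
      radialFactor n a ‖x‖ ‖y‖ m with hg
  have hterm {l : ℝ} (hl : l ∈ Icc (0 : ℝ) 1) :
      HasSum (fun m => l ^ m * g m) (imageTerm n a l x y) :=
    hasSum_imageTerm hn ha0 ha1 hx hy hl
  -- The parameter l = 1 already gives absolute summability, which dominates every other l in [0,1]
  -- and justifies exchanging the sums.
  have hgs : Summable fun m => |g m| := by
    have := (hterm ⟨zero_le_one, le_rfl⟩).summable.abs
    simpa using this
  set f : ℕ × ℕ → ℝ := fun q => (a ^ (n - 2)) ^ q.1 * ((a ^ (2 * q.1)) ^ q.2 * g q.2) with hf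
  have hfs : Summable f := by
    refine Summable.of_norm_bounded ((summable_imageWeight hn ha0 ha1).mul_of_nonneg hgs
      (fun _ => abs_nonneg _) fun _ => abs_nonneg _) fun q => ?_
    rw [hf, norm_mul, norm_mul, Real.norm_eq_abs, Real.norm_eq_abs, Real.norm_eq_abs]
    gcongr
    refine mul_le_of_le_one_left (abs_nonneg _) ?_
    rw [abs_of_nonneg (by positivity)]
    exact pow_le_one₀ (by positivity) (pow_two_mul_mem_Icc ha0 ha1 q.1).2
  have h1 : HasSum (fun j : ℕ => (a ^ (n - 2)) ^ j * imageTerm n a (a ^ (2 * j)) x y)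
      (∑' q, f q) :=
    hfs.hasSum.prod_fiberwise fun j => (hterm (pow_two_mul_mem_Icc ha0 ha1 j)).mul_left _
  rw [imageSeries, h1.tsum_eq]
  have h2 : HasSum (f ∘ Equiv.prodComm ℕ ℕ) (∑' q, f q) :=
    (Equiv.prodComm ℕ ℕ).hasSum_iff.2 hfs.hasSum
  refine h2.prod_fiberwise fun m => ?_
  have hN : a ^ (2 * m + n - 2) < 1 := pow_lt_one₀ ha0.le ha1 (by omega)
  have h3 := (hasSum_geometric_of_lt_one (by positivity) hN).mul_left (g m)
  rw [← div_eq_mul_inv] at h3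
  refine h3.congr_fun fun j => ?_
  simp only [hf, Function.comp_apply, Equiv.prodComm_apply, Prod.swap_prod_mk]
  -- The weight a^((n-2)j) and the power (a^(2j))^m combine into the geometric term of ratio
  -- a^(2m+n-2).
  rw [show 2 * m + n - 2 = 2 * m + (n - 2) by omega]
  ring

lemma radialFactor_eq (hn : 3 ≤ n) {r s : ℝ} (hr : 0 < r) (hs : 0 < s) (m : ℕ) :
    radialFactor n a r s m =
      (r ^ (2 * m + n - 2) * s ^ (2 * m + n - 2) -
        a ^ (2 * m + n - 2) * (r ^ (2 * m + n - 2) + s ^ (2 * m + n - 2)) +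
        a ^ (2 * m + n - 2)) / (r * s) ^ (n + m - 2) := by
  obtain ⟨k, rfl⟩ : ∃ k, n = k + 2 := ⟨n - 2, by omega⟩
  rw [radialFactor, show 2 * m + (k + 2) - 2 = 2 * m + k by omega,
    show k + 2 + m - 2 = k + m by omega, show k + 2 - 2 = k by omega]
  rw [div_pow, div_pow, div_pow, pow_add, pow_add, pow_add, pow_add]
  simp only [mul_pow, pow_mul]
  field_simp
  ring

/-- The expansion of the regular part into zonal harmonics. -/
lemma hasSum_zonal_expansion (hn : 3 ≤ n) (ha0 : 0 < a) (ha1 : a < 1) (hx : x ∈ annulus n a)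
    (hy : y ∈ annulus n a) :
    HasSum (fun m : ℕ =>
      (‖x‖ ^ (2 * m + n - 2) * ‖y‖ ^ (2 * m + n - 2)
          - a ^ (2 * m + n - 2) * (‖x‖ ^ (2 * m + n - 2) + ‖y‖ ^ (2 * m + n - 2))
          + a ^ (2 * m + n - 2)) /
        ((2 * (m : ℝ) + n - 2) * (‖x‖ * ‖y‖) ^ (n + m - 2) * (1 - a ^ (2 * m + n - 2))) *
        zonalHarmonic n m (‖x‖⁻¹ • x) (‖y‖⁻¹ • y))
      (1 / ((n : ℝ) - 2) * imageSeries n a x y) := by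
  have hn' : (3 : ℝ) ≤ n := by exact_mod_cast hn
  have hr : 0 < ‖x‖ := ha0.trans hx.1
  have hs : 0 < ‖y‖ := ha0.trans hy.1
  refine ((hasSum_imageSeries hn ha0 ha1 hx hy).mul_left (1 / ((n : ℝ) - 2))).congr_fun
    fun m => ?_
  have hN : a ^ (2 * m + n - 2) < 1 := pow_lt_one₀ ha0.le ha1 (by omega)
  have h1 : 1 - a ^ (2 * m + n - 2) ≠ 0 := by linarith
  have h2 : (n : ℝ) - 2 ≠ 0 := by linarith
  have h3 : 2 * (m : ℝ) + n - 2 ≠ 0 := by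
    have : (0 : ℝ) ≤ m := by positivity
    linarith
  have hi : inner ℝ (‖x‖⁻¹ • x) (‖y‖⁻¹ • y) = inner ℝ x y / (‖x‖ * ‖y‖) := by
    rw [real_inner_smul_left, real_inner_smul_right]
    field_simp
  have hu : ‖‖x‖⁻¹ • x‖ = 1 := by rw [norm_smul, norm_inv, norm_norm, inv_mul_cancel₀ hr.ne']
  rw [zonalHarmonic_eq hn m hu, hi, radialFactor_eq hn hr hs]
  field_simp

end Series

/-! ### Dimension of the harmonic homogeneous polynomials. -/

section HarmonicDimension

open MvPolynomial

/-- The formal Laplacian on polynomials in `n` variables. -/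
noncomputable def polyLaplacian (n : ℕ) : MvPolynomial (Fin n) ℝ →ₗ[ℝ] MvPolynomial (Fin n) ℝ :=
  ∑ i : Fin n, (pderiv (R := ℝ) i).toLinearMap ∘ₗ (pderiv (R := ℝ) i).toLinearMap

lemma polyLaplacian_apply {n : ℕ} (p : MvPolynomial (Fin n) ℝ) :
    polyLaplacian n p = ∑ i, pderiv i (pderiv i p) := by
  simp [polyLaplacian]

lemma harmonicPolynomials_eq (n m : ℕ) :
    harmonicPolynomials n m = homogeneousSubmodule (Fin n) ℝ m ⊓ (polyLaplacian n).ker := rfl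

/-- If `s i ≤ 1` the coefficient vanishes, so the truncated subtraction in the exponent is harmless.
-/
lemma pderiv_pderiv_monomial {n : ℕ} (i : Fin n) (s : Fin n →₀ ℕ) :
    pderiv i (pderiv i (monomial s (1 : ℝ))) =
      monomial (s - Finsupp.single i 2) ((s i : ℝ) * (s i - 1)) := by
  rw [pderiv_monomial, pderiv_monomial, tsub_tsub, ← Finsupp.single_add]
  congr 1
  rcases h : s i with _ | k <;> simp [h]

lemma polyLaplacian_isHomogeneous {n m : ℕ} {p : MvPolynomial (Fin n) ℝ}
    (hp : p.IsHomogeneous m) : (polyLaplacian n p).IsHomogeneous (m - 2) := by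
  rw [polyLaplacian_apply]
  exact IsHomogeneous.sum _ _ _ fun i _ => hp.pderiv.pderiv

/-- Applying the Laplacian to x_{i₀}² times the monomial returns a positive multiple of the
monomial, plus terms of higher degree in x_{i₀}. Hence induction on the codegree `d` in that
variable. -/
lemma monomial_mem_map_polyLaplacian {n m : ℕ} (i₀ : Fin n) (d : ℕ) (s : Fin n →₀ ℕ)
    (hs : s.degree = m) (hd : s i₀ + d = m) :
    monomial s (1 : ℝ) ∈ (homogeneousSubmodule (Fin n) ℝ (m + 2)).map (polyLaplacian n) := by
  induction d using Nat.strong_induction_on generalizing s with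
  | _ d ih =>
  set M := (homogeneousSubmodule (Fin n) ℝ (m + 2)).map (polyLaplacian n) with hM
  set t := s + Finsupp.single i₀ 2 with ht
  have htd : t.degree = m + 2 := by rw [ht, Finsupp.degree.map_add, hs, Finsupp.degree_single]
  have ht0 : t i₀ = s i₀ + 2 := by simp [ht]
  have hmem : polyLaplacian n (monomial t 1) ∈ M :=
    Submodule.mem_map_of_mem (isHomogeneous_monomial 1 htd)
  have hrest : ∑ i ∈ Finset.univ.erase i₀, pderiv i (pderiv i (monomial t (1 : ℝ))) ∈ M := by
    refine Submodule.sum_mem _ fun i hi => ?_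
    have hi : i ≠ i₀ := by simpa using hi
    rw [pderiv_pderiv_monomial]
    by_cases h2 : 2 ≤ t i
    · have hle : Finsupp.single i 2 ≤ t := by simpa using h2
      have hdeg : (t - Finsupp.single i 2).degree = m := by
        have := congrArg Finsupp.degree (tsub_add_cancel_of_le hle)
        rw [Finsupp.degree.map_add, htd, Finsupp.degree_single] at this
        omega
      have h0 : (t - Finsupp.single i 2 : Fin n →₀ ℕ) i₀ = s i₀ + 2 := by
        simp [ht0, hi]
      have hbd : (t - Finsupp.single i 2 : Fin n →₀ ℕ) i₀ ≤ m := hdeg ▸ Finsupp.le_degree _ _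
      -- The exponent of i₀ is now s i₀ + 2; it is at most m, so 2 ≤ d and the codegree drops by
      -- exactly two.
      have := ih (d - 2) (by omega) _ hdeg (by omega)
      rw [← mul_one ((t i : ℝ) * (t i - 1)), ← smul_eq_mul, ← smul_monomial]
      exact M.smul_mem _ this
    · have : (t i : ℝ) * (t i - 1) = 0 := by
        have : t i = 0 ∨ t i = 1 := by omega
        rcases this with h | h <;> simp [h]
      rw [this, map_zero]
      exact M.zero_mem
  rw [polyLaplacian_apply, ← Finset.add_sum_erase _ _ (Finset.mem_univ i₀),
    Submodule.add_mem_iff_left _ hrest, pderiv_pderiv_monomial, ht0,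
    show t - Finsupp.single i₀ 2 = s by simp [ht]] at hmem
  have hc : (((s i₀ + 2 : ℕ) : ℝ) * ((s i₀ + 2 : ℕ) - 1)) ≠ 0 := by
    push_cast
    have : (0 : ℝ) ≤ s i₀ := by positivity
    have : (0 : ℝ) < ((s i₀ : ℝ) + 2) * (s i₀ + 2 - 1) := mul_pos (by linarith) (by linarith)
    exact this.ne'
  rw [← mul_one (((s i₀ + 2 : ℕ) : ℝ) * ((s i₀ + 2 : ℕ) - 1)), ← smul_eq_mul,
    ← smul_monomial] at hmem
  exact (M.smul_mem_iff hc).1 hmem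

lemma homogeneousSubmodule_eq_restrictSupport (n m : ℕ) :
    homogeneousSubmodule (Fin n) ℝ m = restrictSupport ℝ {s | s.degree = m} :=
  homogeneousSubmodule_eq_finsupp_supported _ _ m

/-- The Laplacian maps homogeneous polynomials of degree `m + 2` onto those of degree `m`. -/
lemma map_polyLaplacian {n : ℕ} (hn : 0 < n) (m : ℕ) :
    (homogeneousSubmodule (Fin n) ℝ (m + 2)).map (polyLaplacian n) =
      homogeneousSubmodule (Fin n) ℝ m := by
  refine le_antisymm ?_ ?_
  · rintro _ ⟨p, hp, rfl⟩
    exact polyLaplacian_isHomogeneous hp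
  · rw [homogeneousSubmodule_eq_restrictSupport n m, restrictSupport_eq_span, Submodule.span_le]
    rintro _ ⟨s, hs, rfl⟩
    have h : s ⟨0, hn⟩ ≤ m := (show s.degree = m from hs) ▸ Finsupp.le_degree _ _
    exact monomial_mem_map_polyLaplacian ⟨0, hn⟩ (m - s ⟨0, hn⟩) s hs (by omega)

lemma finrank_homogeneousSubmodule (n m : ℕ) :
    Module.finrank ℝ (homogeneousSubmodule (Fin n) ℝ m) = (n + m - 1).choose m := by
  rw [homogeneousSubmodule_eq_restrictSupport,
    Module.finrank_eq_nat_card_basis (basisRestrictSupport ℝ _)]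
  have : {s : Fin n →₀ ℕ | s.degree = m} = (Finset.univ.finsuppAntidiag m : Finset (Fin n →₀ ℕ)) := by
    ext s
    simp [Finsupp.degree_eq_sum]
  rw [this, Nat.card_coe_set_eq, Set.ncard_coe_finset, Finset.card_finsuppAntidiag_nat_eq_choose,
    Finset.card_univ, Fintype.card_fin]

/-- Rank-nullity for the Laplacian on degree m+2, whose range is all of degree m. -/
lemma finrank_harmonicPolynomials_add_two {n : ℕ} (hn : 0 < n) (m : ℕ) :
    Module.finrank ℝ (harmonicPolynomials n (m + 2)) + (n + m - 1).choose m =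
      (n + m + 1).choose (m + 2) := by
  set P := homogeneousSubmodule (Fin n) ℝ (m + 2) with hP
  have : Module.Finite ℝ P := Module.Finite.iff_fg.2 (homogeneousSubmodule_fg ..)
  have h := ((polyLaplacian n).domRestrict P).finrank_range_add_finrank_ker
  rw [LinearMap.range_domRestrict, map_polyLaplacian hn, LinearMap.ker_domRestrict,
    finrank_homogeneousSubmodule, finrank_homogeneousSubmodule,
    LinearEquiv.finrank_eq (Submodule.equivMapOfInjective P.subtype P.injective_subtype _),
    Submodule.map_comap_subtype, ← harmonicPolynomials_eq] at h
  rw [add_comm, h]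
  congr 1

lemma harmonicPolynomials_of_lt_two {n m : ℕ} (hm : m < 2) :
    harmonicPolynomials n m = homogeneousSubmodule (Fin n) ℝ m := by
  rw [harmonicPolynomials_eq, inf_eq_left]
  intro p hp
  have h1 (i : Fin n) : (pderiv i p).IsHomogeneous 0 := by
    have : (pderiv i p).IsHomogeneous (m - 1) := IsHomogeneous.pderiv hp
    rwa [show m - 1 = 0 by omega] at this
  rw [LinearMap.mem_ker, polyLaplacian_apply]
  refine Finset.sum_eq_zero fun i _ => ?_
  rw [totalDegree_eq_zero_iff_eq_C.1 ((totalDegree_zero_iff_isHomogeneous _).2 (h1 i)), pderiv_C]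

/-- The dimension of the space of harmonic homogeneous polynomials. -/
theorem finrank_harmonicPolynomials {n : ℕ} (hn : 3 ≤ n) (m : ℕ) :
    Module.finrank ℝ (harmonicPolynomials n m) = harmonicWeight n m := by
  obtain ⟨N, rfl⟩ : ∃ N, n = N + 3 := ⟨n - 3, by omega⟩
  match m with
  | 0 =>
    rw [harmonicPolynomials_of_lt_two (by norm_num), finrank_homogeneousSubmodule, harmonicWeight,
      if_pos rfl, Nat.choose_zero_right]
  | 1 =>
    rw [harmonicPolynomials_of_lt_two (by norm_num), finrank_homogeneousSubmodule, harmonicWeight,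
      if_neg one_ne_zero]
    simp [Nat.choose_succ_self_right]
  | m + 2 =>
    have h := finrank_harmonicPolynomials_add_two (n := N + 3) (by omega) m
    rw [harmonicWeight, if_neg (by omega)]
    rw [Nat.choose_symm_of_eq_add (show N + 3 + m - 1 = m + (N + 1 + 1) by omega),
      Nat.choose_symm_of_eq_add (show N + 3 + m + 1 = m + 2 + (N + 1 + 1) by omega),
      show N + 3 + m - 1 = N + m + 2 by omega, show N + 3 + m + 1 = N + m + 2 + 1 + 1 by omega,
      Nat.choose_succ_succ' (N + m + 2 + 1), Nat.choose_succ_succ' (N + m + 2) (N + 1)] at h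
    rw [show N + 3 + (m + 2) - 2 = N + m + 2 + 1 by omega, show N + 3 - 2 = N + 1 by omega,
      show N + 3 + (m + 2) - 3 = N + m + 2 by omega]
    omega

end HarmonicDimension

/-! ### The Robin function and the final assembly. -/

lemma isRobinFunction_annulus {n : ℕ} {a : ℝ} (hn : 3 ≤ n) (ha0 : 0 < a) (ha1 : a < 1) :
    IsRobinFunction (annulus n a) fun x => annulusRegularPart n a x x :=
  ⟨annulusGreen n a, annulusRegularPart n a, isGreenFunction_annulus hn ha0 ha1,
    isRegularPart_annulus hn ha0 ha1, fun _ _ => rfl⟩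

lemma hasSum_robin_expansion {n : ℕ} {a : ℝ} (hn : 3 ≤ n) (ha0 : 0 < a) (ha1 : a < 1)
    {x : EuclideanSpace ℝ (Fin n)} (hx : x ∈ annulus n a) :
    HasSum (fun m : ℕ =>
      (harmonicWeight n m : ℝ) *
        ((a ^ (2 * m + n - 2) - 2 * a ^ (2 * m + n - 2) * ‖x‖ ^ (2 * m + n - 2)
            + ‖x‖ ^ (4 * m + 2 * n - 4)) /
          ((2 * (m : ℝ) + n - 2) * ‖x‖ ^ (2 * m + 2 * n - 4) * (1 - a ^ (2 * m + n - 2)))))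
      (1 / ((n : ℝ) - 2) * imageSeries n a x x) := by
  have hr : 0 < ‖x‖ := ha0.trans hx.1
  have hu : ‖‖x‖⁻¹ • x‖ = 1 := by rw [norm_smul, norm_inv, norm_norm, inv_mul_cancel₀ hr.ne']
  refine (hasSum_zonal_expansion hn ha0 ha1 hx hx).congr_fun fun m => ?_
  rw [zonalHarmonic_self hn m hu, ← mul_pow, ← pow_two, ← pow_mul, ← pow_mul,
    show 2 * (2 * m + n - 2) = 4 * m + 2 * n - 4 by omega,
    show 2 * (n + m - 2) = 2 * m + 2 * n - 4 by omega]
  ring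

theorem theorem1p1 (n : ℕ) (hn : 3 ≤ n) (a : ℝ) (ha0 : 0 < a) (ha1 : a < 1) :
    -- The Green function and the Robin function of the annulus exist.
    (∃ G, IsGreenFunction (annulus n a) G) ∧
    (∃ R, IsRobinFunction (annulus n a) R) ∧
    -- The formula for the Green function.
    (∀ G, IsGreenFunction (annulus n a) G →
      ∀ x ∈ annulus n a, ∀ y ∈ annulus n a, x ≠ y →
        ∃ S : ℝ,
          HasSum (fun m : ℕ =>
            (‖x‖ ^ (2 * m + n - 2) * ‖y‖ ^ (2 * m + n - 2)
                - a ^ (2 * m + n - 2) * (‖x‖ ^ (2 * m + n - 2) + ‖y‖ ^ (2 * m + n - 2))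
                + a ^ (2 * m + n - 2)) /
              ((2 * (m : ℝ) + n - 2) * (‖x‖ * ‖y‖) ^ (n + m - 2) * (1 - a ^ (2 * m + n - 2))) *
              zonalHarmonic n m (‖x‖⁻¹ • x) (‖y‖⁻¹ • y)) S ∧
          G x y = 1 / (((n : ℝ) - 2) * sphereArea n * ‖x - y‖ ^ (n - 2))
            - 1 / sphereArea n * S) ∧
    -- The formula for the Robin function.
    (∀ R, IsRobinFunction (annulus n a) R →
      ∀ x ∈ annulus n a,
        ∃ S : ℝ,
          HasSum (fun m : ℕ =>
            (harmonicWeight n m : ℝ) *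
              ((a ^ (2 * m + n - 2) - 2 * a ^ (2 * m + n - 2) * ‖x‖ ^ (2 * m + n - 2)
                  + ‖x‖ ^ (4 * m + 2 * n - 4)) /
                ((2 * (m : ℝ) + n - 2) * ‖x‖ ^ (2 * m + 2 * n - 4) *
                  (1 - a ^ (2 * m + n - 2))))) S ∧
          R x = -(1 / sphereArea n) * S) ∧
    -- The weights are the dimensions of the spaces of harmonic homogeneous polynomials.
    (∀ m : ℕ, Module.finrank ℝ (harmonicPolynomials n m) = harmonicWeight n m) := by
  have hn' : (3 : ℝ) ≤ n := by exact_mod_cast hn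
  have h2 : (n : ℝ) - 2 ≠ 0 := by linarith
  have hω : sphereArea n ≠ 0 := (sphereArea_pos (by omega)).ne'
  refine ⟨⟨_, isGreenFunction_annulus hn ha0 ha1⟩, ⟨_, isRobinFunction_annulus hn ha0 ha1⟩,
    fun G hG x hx y hy hxy => ?_, fun R hR x hx => ?_, finrank_harmonicPolynomials hn⟩
  · refine ⟨_, hasSum_zonal_expansion hn ha0 ha1 hx hy, ?_⟩
    rw [hG.eq_of_ne (by omega) isOpen_annulus isBounded_annulus
      (isGreenFunction_annulus hn ha0 ha1) hx hy hxy]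
    simp only [annulusGreen, annulusRegularPart, newtonKernel]
    field_simp
    ring
  · obtain ⟨G, H, hG, hH, hRH⟩ := hR
    refine ⟨_, hasSum_robin_expansion hn ha0 ha1 hx, ?_⟩
    rw [hRH x hx, hH.eq_annulusRegularPart hn ha0 ha1 hG hx, annulusRegularPart]
    field_simp
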